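/- Let $0<\kappa<1$ and $\lambda=\sqrt{1-\kappa^2}$. For complex $T$ near $0$ put $$f(T)=\int_0^T {}_2F_1\left(\tfrac14,\tfrac34;\tfrac12;\kappa^2\sin^2 t\right)\,dt ,$$ the integral being taken along the segment from $0$ to $T$. Let $\varphi$ be the analytic inverse of $f$ on a sufficiently small open disc $D$ about $0$ (so $\varphi(0)=0$), and let $\psi$ be the analytic function on $D$ with $\psi(0)=0$ and $\sin\psi=\kappa\sin\varphi$. Theorem. (i) There is exactly one meromorphic function $\mathrm{dn}_2$ on $\mathbb{C}$ whose restriction to some such disc $D$ is $\cos\psi$. (ii) There is exactly one pair of real numbers $K>0$, $K'>0$ such that $2K$ and $2iK'$ are fundamental periods of the Weierstrass function $\wp$ with invariants $g_2=\tfrac43-\kappa^2$ and $g_3=\tfrac8{27}-\tfrac13\kappa^2$, that is, such that the lattice $2K\mathbb{Z}+2iK'\mathbb{Z}$ has these invariants. (iii) The function $\mathrm{dn}_2$ is elliptic with $2K$ and $2iK'$ as fundamental periods: its set of periods is exactly $2K\mathbb{Z}+2iK'\mathbb{Z}$. It has a double pole at $iK'$; moreover $\mathrm{dn}_2(K)=\lambda$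 and $\mathrm{dn}_2(K+iK')=-\lambda$. -/

import Mathlib

noncomputable section

namespace ShenDn

/-- The function `f(T) = ∫₀ᵀ F(1/4, 3/4; 1/2; κ² sin² t) dt`, where `F = ₂F₁` and the integral is
taken along the straight segment `t = s T`, `0 ≤ s ≤ 1`, from `0` to the complex number `T`.
(It is only used for `T` near `0`, where `|κ² sin² t| < 1` on the segment.) -/
def f (κ : ℝ) (T : ℂ) : ℂ :=
  ∫ s in (0 : ℝ)..1,
    ordinaryHypergeometric (1 / 4 : ℂ) (3 / 4 : ℂ) (1 / 2 : ℂ)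
      ((κ : ℂ) ^ 2 * Complex.sin ((s : ℂ) * T) ^ 2) * T

/-- On the open disc of radius `r > 0` about `0`, `φ` is the analytic inverse of `f κ` and `ψ` is
the analytic function with `ψ 0 = 0` and `sin ψ = κ sin φ`. -/
structure IsLocalData (κ r : ℝ) (φ ψ : ℂ → ℂ) : Prop where
  radius_pos : 0 < r
  analytic_phi : AnalyticOnNhd ℂ φ (Metric.ball 0 r)
  phi_zero : φ 0 = 0
  right_inv : ∀ u ∈ Metric.ball (0 : ℂ) r, f κ (φ u) = u
  left_inv : ∀ᶠ T in nhds (0 : ℂ), φ (f κ T) = T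
  analytic_psi : AnalyticOnNhd ℂ ψ (Metric.ball 0 r)
  psi_zero : ψ 0 = 0
  sin_psi : ∀ u ∈ Metric.ball (0 : ℂ) r, Complex.sin (ψ u) = (κ : ℂ) * Complex.sin (φ u)

/-- `d` is the function `dn₂` of modulus `κ`: the meromorphic function on the whole plane that
restricts to `cos ψ` on a disc about `0`. Meromorphic functions are taken in Mathlib's normal form,
i.e. `d` is analytic at each point that is not a pole, and has the default value `0` at its poles;
so equalities of values, periodicity included, are equalities of meromorphic functions. -/
def IsDn2 (κ : ℝ) (d : ℂ → ℂ) : Prop :=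
  MeromorphicNFOn d Set.univ ∧
    ∃ (r : ℝ) (φ ψ : ℂ → ℂ), IsLocalData κ r φ ψ ∧
      ∀ u ∈ Metric.ball (0 : ℂ) r, d u = Complex.cos (ψ u)

/-- `K, K' > 0`, and `2K`, `2iK'` are fundamental periods of the Weierstrass function with
invariants `g₂ = 4/3 - κ²` and `g₃ = 8/27 - κ²/3`: these are the invariants of the lattice
that is generated by `2K` and `2iK'`. -/
def IsHalfPeriods (κ K K' : ℝ) : Prop :=
  0 < K ∧ 0 < K' ∧
    ∃ L : PeriodPair, L.ω₁ = 2 * (K : ℂ) ∧ L.ω₂ = 2 * Complex.I * (K' : ℂ) ∧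
      L.g₂ = 4 / 3 - (κ : ℂ) ^ 2 ∧ L.g₃ = 8 / 27 - (κ : ℂ) ^ 2 / 3

/-- `ω₁`, `ω₂` are fundamental periods of `d`: they are linearly independent over `ℝ`, and the
periods of `d` are exactly their integral linear combinations. -/
def IsFundamentalPeriods (d : ℂ → ℂ) (ω₁ ω₂ : ℂ) : Prop :=
  LinearIndependent ℝ ![ω₁, ω₂] ∧
    ∀ ω : ℂ, Function.Periodic d ω ↔ ∃ m n : ℤ, ω = (m : ℂ) * ω₁ + (n : ℂ) * ω₂

end ShenDn

end

/-! The even part of the binomial series of `(1 + w) ^ (-1/2)` sums the hypergeometric function: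
with `w = sin p`, the squares `1 ± sin p = (cos (p/2) ± sin (p/2)) ^ 2` give `F(1/4, 3/4; 1/2; sin²
p) = cos (p/2) / cos p` near `0`. Inverting the integral gives `φ' = cos ψ / cos (ψ/2)`, and `d =
cos ψ` then solves `d'' = 1 - κ² + 2 d - 3 d²`, `d 0 = 1`, `d' 0 = 0` (`IsLocalData.isGerm`). An
order-of-vanishing argument shows that this problem has one analytic germ, so `dn₂` is characterised
by it (`isDn2_iff`).

For a rectangular lattice with the prescribed invariants, `1/3 - 2 ℘(u + iK')` solves the same
problem. The equation follows from `℘'' = 6 ℘² - g₂/2`, and the initial values from `℘(iK') = -1/3`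
and `℘'(iK') = 0`. The cubic of `℘` has roots `-1/3 < 1/6 - λ/2 < 1/6 + λ/2`. Which root is taken at
which half-period is decided by the reality of `℘` and the sign of `℘'²` on the sides of the
rectangle with corners `0`, `K`, `K + iK'`, `iK'`. This yields all values, poles and periods.

The half-periods are unique because the lattice is the period group of the unique `dn₂`. They exist
because `E₆ / E₄ ^ (3/2)` on the imaginary axis takes every value in `(-1, 1)`
(`exists_eisAxis_eq`); scaling the lattice then adjusts both invariants. -/

section

open Filter Topology

/-! ### The hypergeometric integral and the differential equation of `cos ψ` -/

/-- The recurrence of the generalized binomial coefficients. -/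
lemma Ring.succ_mul_choose_succ {K : Type*} [Field K] [CharZero K] (a : K) (n : ℕ) :
    ((n : K) + 1) * Ring.choose a (n + 1) = (a - n) * Ring.choose a n := by
  have hn : (n.factorial : K) ≠ 0 := by exact_mod_cast n.factorial_ne_zero
  have hn1 : ((n : K) + 1) ≠ 0 := by exact_mod_cast n.succ_ne_zero
  rw [Ring.choose_eq_smul, Ring.choose_eq_smul, descPochhammer_succ_right, Nat.factorial_succ]
  simp only [Polynomial.smeval_mul, Polynomial.smeval_sub, Polynomial.smeval_X,
    Polynomial.smeval_natCast, smul_eq_mul, pow_one, pow_zero, nsmul_eq_mul, mul_one]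
  push_cast
  field_simp

namespace ShenDn

lemma choose_neg_half_two_mul (n : ℕ) :
    Ring.choose (-(1 / 2) : ℂ) (2 * n) =
      ordinaryHypergeometricCoefficient (1 / 4 : ℂ) (3 / 4) (1 / 2) n := by
  induction n with
  | zero => simp [ordinaryHypergeometricCoefficient]
  | succ n ih =>
    have h1 := Ring.succ_mul_choose_succ (-(1 / 2) : ℂ) (2 * n)
    have h2 := Ring.succ_mul_choose_succ (-(1 / 2) : ℂ) (2 * n + 1)
    rw [ih] at h1
    have ha : ((n : ℂ) + 1) ≠ 0 := by exact_mod_cast n.succ_ne_zero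
    have hb : (2 * (n : ℂ) + 1) ≠ 0 := by exact_mod_cast (2 * n).succ_ne_zero
    have hc : (1 / 2 + (n : ℂ)) = (2 * n + 1) / 2 := by ring
    have hd : (2 * (n : ℂ) + 1 + 1) ≠ 0 := by
      intro h; apply ha; linear_combination h / 2
    have hP : (ascPochhammer ℂ n).eval (1 / 2 : ℂ) ≠ 0 := by
      intro h
      obtain ⟨k, -, hk⟩ := (ascPochhammer_eval_eq_zero_iff n _).1 h
      have : (2 * (k : ℂ) + 1) ≠ 0 := by exact_mod_cast (2 * k).succ_ne_zero
      apply this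
      linear_combination 2 * hk
    have hf : (n.factorial : ℂ) ≠ 0 := by exact_mod_cast n.factorial_ne_zero
    push_cast at h1 h2
    have e1 : Ring.choose (-(1 / 2) : ℂ) (2 * n + 1) = (-(1 / 2) - 2 * n) / (2 * n + 1) *
        ordinaryHypergeometricCoefficient (1 / 4 : ℂ) (3 / 4) (1 / 2) n := by
      rw [div_mul_eq_mul_div, eq_div_iff hb]
      linear_combination h1
    have e2 : Ring.choose (-(1 / 2) : ℂ) (2 * n + 1 + 1) = (-(1 / 2) - (2 * n + 1)) /
        (2 * n + 1 + 1) * Ring.choose (-(1 / 2) : ℂ) (2 * n + 1) := by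
      rw [div_mul_eq_mul_div, eq_div_iff hd]
      linear_combination h2
    rw [show 2 * (n + 1) = 2 * n + 1 + 1 by ring, e2, e1]
    simp only [ordinaryHypergeometricCoefficient, ascPochhammer_succ_eval, Nat.factorial_succ]
    push_cast
    rw [hc]
    field_simp
    ring

/-- The closed form of `F(1/4, 3/4; 1/2; w²)`. -/
lemma ordinaryHypergeometric_sq {w : ℂ} (hw : ‖w‖ < 1) :
    ordinaryHypergeometric (1 / 4 : ℂ) (3 / 4 : ℂ) (1 / 2 : ℂ) (w ^ 2) =
      ((1 + w) ^ (-(1 / 2) : ℂ) + (1 - w) ^ (-(1 / 2) : ℂ)) / 2 := by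
  have key (v : ℂ) (hv : ‖v‖ < 1) : HasSum (fun n : ℕ ↦ Ring.choose (-(1 / 2) : ℂ) n * v ^ n)
      ((1 + v) ^ (-(1 / 2) : ℂ)) := by
    have := (Complex.one_add_cpow_hasFPowerSeriesOnBall_zero (a := (-(1 / 2) : ℂ))).hasSum
      (y := v) (by simpa [enorm_eq_nnnorm] using! hv)
    simpa [binomialSeries_apply, List.ofFn_const, List.prod_replicate,
      -FormalMultilinearSeries.apply_eq_prod_smul_coeff] using this
  have h1 := ((key w hw).add (key (-w) (by simpa using hw))).div_const 2
  rw [← sub_eq_add_neg] at h1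
  have h2 : HasSum (fun n : ℕ ↦ Ring.choose (-(1 / 2) : ℂ) (2 * n) * w ^ (2 * n))
      (((1 + w) ^ (-(1 / 2) : ℂ) + (1 - w) ^ (-(1 / 2) : ℂ)) / 2) := by
    have hinj : Function.Injective (fun n : ℕ ↦ 2 * n) := fun a b h ↦ by simpa using h
    rw [← hinj.hasSum_iff] at h1
    · refine h1.congr_fun ?_
      intro n
      simp only [Function.comp, (even_two_mul n).neg_pow]
      ring
    · intro n hn
      have : Odd n := by
        rw [← Nat.not_even_iff_odd]
        rintro ⟨m, rfl⟩
        exact hn ⟨m, by simp only; ring⟩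
      rw [this.neg_pow]
      ring
  rw [ordinaryHypergeometric_eq_tsum, ← h2.tsum_eq]
  refine tsum_congr fun n ↦ ?_
  rw [choose_neg_half_two_mul, pow_mul, smul_eq_mul]

/-- A positive real part keeps the argument inside `(-π/2, π/2)`, so the principal square root of `x
^ 2` is `x` and not `-x`. -/
lemma sq_cpow_neg_half {x : ℂ} (hx : 0 < x.re) : (x ^ 2) ^ (-(1 / 2) : ℂ) = x⁻¹ := by
  have h := Complex.pow_cpow_nat_inv (x := x) (n := 2) two_ne_zero
  have harg := Complex.abs_arg_lt_pi_div_two_iff.2 (Or.inl hx)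
  rw [abs_lt] at harg
  rw [Complex.cpow_neg, one_div]
  congr 1
  exact_mod_cast h (by exact_mod_cast harg.1) (by exact_mod_cast harg.2.le)

lemma eventually_ordinaryHypergeometric_sin_sq : ∀ᶠ p in 𝓝 (0 : ℂ),
    ordinaryHypergeometric (1 / 4 : ℂ) (3 / 4 : ℂ) (1 / 2 : ℂ) (Complex.sin p ^ 2) =
      Complex.cos (p / 2) / Complex.cos p := by
  have c1 : ∀ᶠ p in 𝓝 (0 : ℂ), ‖Complex.sin p‖ < 1 :=
    (by fun_prop : Continuous fun p : ℂ ↦ ‖Complex.sin p‖).continuousAt.eventually_lt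
      continuousAt_const (by simp)
  have c2 : ∀ᶠ p in 𝓝 (0 : ℂ), 0 < (Complex.cos (p / 2) + Complex.sin (p / 2)).re :=
    continuousAt_const.eventually_lt (by fun_prop : Continuous fun p : ℂ ↦
      (Complex.cos (p / 2) + Complex.sin (p / 2)).re).continuousAt (by simp)
  have c3 : ∀ᶠ p in 𝓝 (0 : ℂ), 0 < (Complex.cos (p / 2) - Complex.sin (p / 2)).re :=
    continuousAt_const.eventually_lt (by fun_prop : Continuous fun p : ℂ ↦
      (Complex.cos (p / 2) - Complex.sin (p / 2)).re).continuousAt (by simp)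
  filter_upwards [c1, c2, c3] with p h1 h2 h3
  have hs : Complex.sin p = 2 * Complex.sin (p / 2) * Complex.cos (p / 2) := by
    rw [← Complex.sin_two_mul]; ring_nf
  have hc : Complex.cos p = Complex.cos (p / 2) ^ 2 - Complex.sin (p / 2) ^ 2 := by
    rw [← Complex.cos_two_mul']; ring_nf
  have hcs := Complex.sin_sq_add_cos_sq (p / 2)
  rw [ordinaryHypergeometric_sq h1,
    show 1 + Complex.sin p = (Complex.cos (p / 2) + Complex.sin (p / 2)) ^ 2 by
      rw [hs]; linear_combination -hcs,
    show 1 - Complex.sin p = (Complex.cos (p / 2) - Complex.sin (p / 2)) ^ 2 by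
      rw [hs]; linear_combination -hcs,
    sq_cpow_neg_half h2, sq_cpow_neg_half h3, hc]
  have n2 : Complex.cos (p / 2) + Complex.sin (p / 2) ≠ 0 := fun h ↦ by simp [h] at h2
  have n3 : Complex.cos (p / 2) - Complex.sin (p / 2) ≠ 0 := fun h ↦ by simp [h] at h3
  have n4 : Complex.cos (p / 2) ^ 2 - Complex.sin (p / 2) ^ 2 ≠ 0 := by
    rw [sq_sub_sq]; exact mul_ne_zero n2 n3
  field_simp
  ring

/-- The integrand of `f κ`. -/
noncomputable def g (κ : ℝ) (T : ℂ) : ℂ :=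
  ordinaryHypergeometric (1 / 4 : ℂ) (3 / 4 : ℂ) (1 / 2 : ℂ) ((κ : ℂ) ^ 2 * Complex.sin T ^ 2)

/-- The closed form makes the integrand holomorphic on a disc where `|κ sin T| < 1`; it has a
primitive `G` there, and the integral along the segment is `G T - G 0`. -/
lemma eventually_hasDerivAt_f (κ : ℝ) : ∀ᶠ T in 𝓝 (0 : ℂ), HasDerivAt (f κ) (g κ T) T := by
  have c1 : ∀ᶠ T in 𝓝 (0 : ℂ), ‖(κ : ℂ) * Complex.sin T‖ < 1 :=
    (by fun_prop : Continuous fun T : ℂ ↦ ‖(κ : ℂ) * Complex.sin T‖).continuousAt.eventually_lt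
      continuousAt_const (by simp)
  obtain ⟨ρ, hρ, hball⟩ := Metric.eventually_nhds_iff_ball.1 c1
  have hg : ∀ T ∈ Metric.ball (0 : ℂ) ρ, g κ T =
      ((1 + κ * Complex.sin T) ^ (-(1 / 2) : ℂ) +
        (1 - κ * Complex.sin T) ^ (-(1 / 2) : ℂ)) / 2 := by
    intro T hT
    rw [g, ← mul_pow, ordinaryHypergeometric_sq (hball T hT)]
  have hd : DifferentiableOn ℂ (g κ) (Metric.ball 0 ρ) := by
    refine DifferentiableOn.congr ?_ hg
    intro T hT
    have h1 : 1 + κ * Complex.sin T ∈ Complex.slitPlane :=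
      Complex.mem_slitPlane_of_norm_lt_one (hball T hT)
    have h2 : 1 - κ * Complex.sin T ∈ Complex.slitPlane := by
      rw [sub_eq_add_neg]
      exact Complex.mem_slitPlane_of_norm_lt_one (by rw [norm_neg]; exact hball T hT)
    apply DifferentiableAt.differentiableWithinAt
    have e1 : DifferentiableAt ℂ (fun T : ℂ ↦ (1 + κ * Complex.sin T) ^ (-(1 / 2) : ℂ)) T :=
      DifferentiableAt.cpow_const (by fun_prop) h1
    have e2 : DifferentiableAt ℂ (fun T : ℂ ↦ (1 - κ * Complex.sin T) ^ (-(1 / 2) : ℂ)) T :=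
      DifferentiableAt.cpow_const (by fun_prop) h2
    exact (e1.add e2).div_const 2
  obtain ⟨G, hG⟩ := hd.isExactOn_ball
  have hf : ∀ T ∈ Metric.ball (0 : ℂ) ρ, f κ T = G T - G 0 := by
    intro T hT
    have hmem : ∀ s ∈ Set.uIcc (0 : ℝ) 1, (s : ℂ) * T ∈ Metric.ball (0 : ℂ) ρ := by
      intro s hs
      rw [Set.uIcc_of_le zero_le_one] at hs
      rw [mem_ball_zero_iff] at hT ⊢
      rw [norm_mul, Complex.norm_real, Real.norm_of_nonneg hs.1]
      exact (mul_le_of_le_one_left (norm_nonneg _) hs.2).trans_lt hT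
    have hderiv : ∀ s ∈ Set.uIcc (0 : ℝ) 1,
        HasDerivAt (fun s : ℝ ↦ G ((s : ℂ) * T)) (g κ ((s : ℂ) * T) * T) s := by
      intro s hs
      have h1 : HasDerivAt (fun z : ℂ ↦ z * T) T (s : ℂ) := by
        simpa using (hasDerivAt_id (s : ℂ)).mul_const T
      exact ((hG _ (hmem s hs)).comp (s : ℂ) h1).comp_ofReal
    have hcont : ContinuousOn (fun s : ℝ ↦ g κ ((s : ℂ) * T) * T) (Set.uIcc 0 1) := by
      refine ContinuousOn.mul ?_ continuousOn_const
      exact hd.continuousOn.comp (by fun_prop) hmem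
    have := intervalIntegral.integral_eq_sub_of_hasDerivAt hderiv hcont.intervalIntegrable
    simpa [f, g] using this
  filter_upwards [Metric.ball_mem_nhds (0 : ℂ) hρ] with T hT
  have h1 : HasDerivAt (fun T ↦ G T - G 0) (g κ T) T := (hG T hT).sub_const _
  refine h1.congr_of_eventuallyEq ?_
  filter_upwards [Metric.isOpen_ball.mem_nhds hT] with z hz using hf z hz

lemma f_zero (κ : ℝ) : f κ 0 = 0 := by simp [f]

lemma analyticAt_f (κ : ℝ) : AnalyticAt ℂ (f κ) 0 := by
  rw [Complex.analyticAt_iff_eventually_differentiableAt]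
  filter_upwards [eventually_hasDerivAt_f κ] with T h using h.differentiableAt

lemma deriv_f_zero (κ : ℝ) : deriv (f κ) 0 = 1 := by
  rw [(eventually_hasDerivAt_f κ).self_of_nhds.deriv]
  simp [g]

/-- The analytic local inverse of an analytic germ that fixes `0`. -/
lemma exists_analyticAt_inverse {h : ℂ → ℂ} (hh : AnalyticAt ℂ h 0) (h0 : h 0 = 0)
    (h' : deriv h 0 ≠ 0) : ∃ k : ℂ → ℂ, AnalyticAt ℂ k 0 ∧ k 0 = 0 ∧
      (∀ᶠ u in 𝓝 (0 : ℂ), h (k u) = u) ∧ ∀ᶠ T in 𝓝 (0 : ℂ), k (h T) = T := by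
  have hs := hh.hasStrictDerivAt
  refine ⟨hs.localInverse h _ 0 h', ?_, ?_, ?_, ?_⟩
  · simpa [h0] using hh.analyticAt_localInverse h'
  · have := (hs.eventually_left_inverse h').self_of_nhds
    rwa [h0] at this
  · simpa [h0] using hs.eventually_right_inverse h'
  · exact hs.eventually_left_inverse h'

lemma exists_isLocalData (κ : ℝ) : ∃ (r : ℝ) (φ ψ : ℂ → ℂ), IsLocalData κ r φ ψ := by
  obtain ⟨φ, hφ, hφ0, hr, hl⟩ := exists_analyticAt_inverse (analyticAt_f κ) (f_zero κ)
    (by rw [deriv_f_zero]; exact one_ne_zero)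
  obtain ⟨S, hS, hS0, hSr, -⟩ := exists_analyticAt_inverse (h := Complex.sin)
    (Complex.analyticAt_sin) Complex.sin_zero (by simp)
  have hc : AnalyticAt ℂ (fun u ↦ (κ : ℂ) * Complex.sin (φ u)) 0 :=
    analyticAt_const.mul (Complex.analyticAt_sin.comp hφ)
  have hc0 : (κ : ℂ) * Complex.sin (φ 0) = 0 := by simp [hφ0]
  have hψ : AnalyticAt ℂ (fun u ↦ S ((κ : ℂ) * Complex.sin (φ u))) 0 :=
    AnalyticAt.fun_comp (by rw [hc0]; exact hS) hc
  have hsin : ∀ᶠ u in 𝓝 (0 : ℂ), Complex.sin (S ((κ : ℂ) * Complex.sin (φ u))) =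
      (κ : ℂ) * Complex.sin (φ u) := by
    have := hc.continuousAt.tendsto
    rw [hc0] at this
    exact this.eventually hSr
  obtain ⟨r, hr0, hball⟩ := Metric.eventually_nhds_iff_ball.1
    (hφ.eventually_analyticAt.and (hψ.eventually_analyticAt.and (hr.and hsin)))
  exact ⟨r, φ, _, hr0, fun u hu ↦ (hball u hu).1, hφ0, fun u hu ↦ (hball u hu).2.2.1, hl,
    fun u hu ↦ (hball u hu).2.1, by simp [hφ0, hS0], fun u hu ↦ (hball u hu).2.2.2⟩

lemma IsLocalData.analyticAt_phi {κ r : ℝ} {φ ψ : ℂ → ℂ} (h : IsLocalData κ r φ ψ) :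
    AnalyticAt ℂ φ 0 := h.analytic_phi 0 (Metric.mem_ball_self h.radius_pos)

lemma IsLocalData.analyticAt_psi {κ r : ℝ} {φ ψ : ℂ → ℂ} (h : IsLocalData κ r φ ψ) :
    AnalyticAt ℂ ψ 0 := h.analytic_psi 0 (Metric.mem_ball_self h.radius_pos)

lemma eventually_cos_ne_zero {h : ℂ → ℂ} (hh : ContinuousAt h 0) (h0 : h 0 = 0) :
    ∀ᶠ u in 𝓝 (0 : ℂ), Complex.cos (h u) ≠ 0 :=
  (Complex.continuous_cos.continuousAt.comp hh).eventually_ne (by simp [h0])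

/-- Differentiate `f (φ u) = u`; since `κ sin φ = sin ψ`, the integrand at `φ u` is `cos (ψ/2) / cos
ψ`. -/
lemma IsLocalData.eventually_hasDerivAt_phi {κ r : ℝ} {φ ψ : ℂ → ℂ} (h : IsLocalData κ r φ ψ) :
    ∀ᶠ u in 𝓝 (0 : ℂ),
      HasDerivAt φ (Complex.cos (ψ u) / Complex.cos (ψ u / 2)) u := by
  have tφ : Tendsto φ (𝓝 0) (𝓝 0) := by
    simpa [h.phi_zero] using h.analyticAt_phi.continuousAt.tendsto
  have tψ : Tendsto ψ (𝓝 0) (𝓝 0) := by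
    simpa [h.psi_zero] using h.analyticAt_psi.continuousAt.tendsto
  have cψ2 : ContinuousAt (fun u ↦ ψ u / 2) 0 := h.analyticAt_psi.continuousAt.div_const 2
  filter_upwards [Metric.ball_mem_nhds (0 : ℂ) h.radius_pos,
    tφ.eventually (eventually_hasDerivAt_f κ),
    tψ.eventually eventually_ordinaryHypergeometric_sin_sq,
    eventually_cos_ne_zero h.analyticAt_psi.continuousAt h.psi_zero,
    eventually_cos_ne_zero cψ2 (by simp [h.psi_zero])] with u hu hf hF hc1 hc2
  have hφ := (h.analytic_phi u hu).differentiableAt.hasDerivAt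
  have hg : g κ (φ u) = Complex.cos (ψ u / 2) / Complex.cos (ψ u) := by
    rw [← hF, h.sin_psi u hu, g, mul_pow]
  have h1 : HasDerivAt (fun u ↦ f κ (φ u)) (g κ (φ u) * deriv φ u) u := hf.comp u hφ
  have h2 : HasDerivAt (fun u ↦ f κ (φ u)) 1 u := by
    refine (hasDerivAt_id u).congr_of_eventuallyEq ?_
    filter_upwards [Metric.isOpen_ball.mem_nhds hu] with z hz using h.right_inv z hz
  have h3 := h1.unique h2
  rw [hg] at h3
  have h4 : Complex.cos (ψ u) / Complex.cos (ψ u / 2) = deriv φ u := by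
    field_simp at h3 ⊢
    exact h3.symm
  rwa [h4]

lemma IsLocalData.eventually_hasDerivAt_psi {κ r : ℝ} {φ ψ : ℂ → ℂ} (h : IsLocalData κ r φ ψ) :
    ∀ᶠ u in 𝓝 (0 : ℂ),
      HasDerivAt ψ (κ * Complex.cos (φ u) / Complex.cos (ψ u / 2)) u := by
  filter_upwards [Metric.ball_mem_nhds (0 : ℂ) h.radius_pos, h.eventually_hasDerivAt_phi,
    eventually_cos_ne_zero h.analyticAt_psi.continuousAt h.psi_zero] with u hu hφ hc1
  have hψ := (h.analytic_psi u hu).differentiableAt.hasDerivAt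
  have h2 : HasDerivAt (fun u ↦ Complex.sin (ψ u))
      (κ * (Complex.cos (φ u) * (Complex.cos (ψ u) / Complex.cos (ψ u / 2)))) u := by
    refine (hφ.csin.const_mul (κ : ℂ)).congr_of_eventuallyEq ?_
    filter_upwards [Metric.isOpen_ball.mem_nhds hu] with z hz using h.sin_psi z hz
  have h3 := hψ.csin.unique h2
  have h4 : κ * Complex.cos (φ u) / Complex.cos (ψ u / 2) = deriv ψ u := by
    apply mul_left_cancel₀ hc1
    rw [h3]
    ring
  rwa [h4]

/-- The germ of `dn₂` at `0`: the solution of `d'' = 1 - κ² + 2 d - 3 d²`, `d 0 = 1`, `d' 0 = 0`. -/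
structure IsGerm (κ : ℝ) (d : ℂ → ℂ) : Prop where
  analyticAt : AnalyticAt ℂ d 0
  apply_zero : d 0 = 1
  deriv_zero : deriv d 0 = 0
  deriv_deriv : ∀ᶠ u in 𝓝 (0 : ℂ), deriv (deriv d) u = 1 - (κ : ℂ) ^ 2 + 2 * d u - 3 * d u ^ 2

lemma IsLocalData.isGerm {κ r : ℝ} {φ ψ : ℂ → ℂ} (h : IsLocalData κ r φ ψ) :
    IsGerm κ fun u ↦ Complex.cos (ψ u) := by
  have cψ2 : ContinuousAt (fun u ↦ ψ u / 2) 0 := h.analyticAt_psi.continuousAt.div_const 2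
  -- The half-angle formula for `sin ψ` cancels the denominator of `ψ'`.
  have hd : ∀ᶠ u in 𝓝 (0 : ℂ), HasDerivAt (fun u ↦ Complex.cos (ψ u))
      (-2 * κ * Complex.sin (ψ u / 2) * Complex.cos (φ u)) u := by
    filter_upwards [h.eventually_hasDerivAt_psi,
      eventually_cos_ne_zero cψ2 (by simp [h.psi_zero])] with u hψ hc
    convert hψ.ccos using 1
    have hs : Complex.sin (ψ u) = 2 * Complex.sin (ψ u / 2) * Complex.cos (ψ u / 2) := by
      rw [← Complex.sin_two_mul]; ring_nf
    rw [hs]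
    field_simp
  refine ⟨Complex.analyticAt_cos.fun_comp h.analyticAt_psi, by simp [h.psi_zero], ?_, ?_⟩
  · rw [hd.self_of_nhds.deriv]
    simp [h.psi_zero]
  · filter_upwards [hd.eventually_nhds, h.eventually_hasDerivAt_psi, h.eventually_hasDerivAt_phi,
      Metric.ball_mem_nhds (0 : ℂ) h.radius_pos,
      eventually_cos_ne_zero cψ2 (by simp [h.psi_zero])] with u hdu hψ hφ hu hc
    have he : deriv (fun u ↦ Complex.cos (ψ u)) =ᶠ[𝓝 u]
        fun u ↦ -2 * κ * Complex.sin (ψ u / 2) * Complex.cos (φ u) := by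
      filter_upwards [hdu] with z hz using hz.deriv
    rw [he.deriv_eq, ((((hψ.div_const 2).csin).const_mul (-2 * (κ : ℂ))).fun_mul hφ.ccos).deriv]
    have hs : Complex.sin (ψ u) = 2 * Complex.sin (ψ u / 2) * Complex.cos (ψ u / 2) := by
      rw [← Complex.sin_two_mul]; ring_nf
    have hc2 : Complex.cos (ψ u) = 2 * Complex.cos (ψ u / 2) ^ 2 - 1 := by
      rw [← Complex.cos_two_mul]; ring_nf
    have hcs := Complex.sin_sq_add_cos_sq (ψ u / 2)
    have hcs2 := Complex.sin_sq_add_cos_sq (φ u)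
    have hk := h.sin_psi u hu
    rw [hs] at hk
    rw [hc2]
    set a := Complex.sin (ψ u / 2)
    set b := Complex.cos (ψ u / 2)
    set s := Complex.sin (φ u)
    set c := Complex.cos (φ u)
    -- This relation and `hk` eliminate `φ`, leaving an identity in the half-angle of `ψ`.
    have hkk : (κ : ℂ) ^ 2 * c ^ 2 = κ ^ 2 - 4 * a ^ 2 * b ^ 2 := by
      linear_combination (κ : ℂ) ^ 2 * hcs2 + (κ * s + 2 * a * b) * hk
    field_simp
    linear_combination (-b) * hkk - 2 * (2 * b ^ 2 - 1) * a * hk + b * (12 * b ^ 2 - 4) * hcs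

end ShenDn

end

/-! ### Uniqueness of the germ and of its meromorphic continuation -/

section

open Filter Topology

/-- An analytic germ that solves a homogeneous linear second order equation with vanishing initial
data is zero. -/
lemma AnalyticAt.eventually_eq_zero_of_deriv_deriv_eq_mul {w h : ℂ → ℂ} {z : ℂ}
    (hw : AnalyticAt ℂ w z) (hh : AnalyticAt ℂ h z) (h0 : w z = 0) (h1 : deriv w z = 0)
    (he : deriv (deriv w) =ᶠ[𝓝 z] fun u ↦ h u * w u) : ∀ᶠ u in 𝓝 z, w u = 0 := by
  rw [← analyticOrderAt_eq_top]
  -- Each derivative lowers the order of vanishing by one, so `ord w = ord h + ord w + 2`, which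
  -- forces `ord w = ⊤`.
  have e1 := hw.analyticOrderAt_deriv_add_one
  have e2 := hw.deriv.analyticOrderAt_deriv_add_one
  have e3 : analyticOrderAt (fun u ↦ h u * w u) z = analyticOrderAt h z + analyticOrderAt w z :=
    analyticOrderAt_mul hh hw
  simp only [h0, h1, sub_zero] at e1 e2
  rw [analyticOrderAt_congr he, e3] at e2
  rw [← e2] at e1
  by_contra hne
  have hle : analyticOrderAt w z + 1 ≤ analyticOrderAt w z := by
    conv_rhs => rw [← e1]
    rw [add_assoc, add_assoc]
    exact (add_le_add_right le_self_add _).trans le_add_self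
  exact absurd hle (not_le.2 (ENat.lt_add_one_iff hne |>.2 le_rfl))

namespace ShenDn

lemma IsGerm.eventuallyEq {κ : ℝ} {d e : ℂ → ℂ} (hd : IsGerm κ d) (he : IsGerm κ e) :
    d =ᶠ[𝓝 0] e := by
  have hw : AnalyticAt ℂ (fun u ↦ d u - e u) 0 := hd.analyticAt.sub he.analyticAt
  -- The factor comes from `2 (d - e) - 3 (d² - e²) = (2 - 3 (d + e)) (d - e)`: the difference of
  -- two solutions solves a linear equation.
  have hh : AnalyticAt ℂ (fun u ↦ 2 - 3 * (d u + e u)) 0 :=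
    analyticAt_const.sub (analyticAt_const.mul (hd.analyticAt.add he.analyticAt))
  have hderiv : ∀ᶠ u in 𝓝 (0 : ℂ), deriv (fun u ↦ d u - e u) u = deriv d u - deriv e u := by
    filter_upwards [hd.analyticAt.eventually_analyticAt, he.analyticAt.eventually_analyticAt]
      with u h1 h2
    exact deriv_fun_sub h1.differentiableAt h2.differentiableAt
  have := hw.eventually_eq_zero_of_deriv_deriv_eq_mul hh (by simp [hd.apply_zero, he.apply_zero])
    (by simp [hderiv.self_of_nhds, hd.deriv_zero, he.deriv_zero]) (by
      filter_upwards [hderiv.eventually_nhds, hd.deriv_deriv, he.deriv_deriv,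
        hd.analyticAt.eventually_analyticAt, he.analyticAt.eventually_analyticAt]
        with u h h1 h2 h3 h4
      rw [Filter.EventuallyEq.deriv_eq h, deriv_fun_sub h3.deriv.differentiableAt
        h4.deriv.differentiableAt, h1, h2]
      ring)
  filter_upwards [this] with u hu using sub_eq_zero.1 hu

lemma IsGerm.congr {κ : ℝ} {d e : ℂ → ℂ} (hd : IsGerm κ d) (h : e =ᶠ[𝓝 0] d) : IsGerm κ e where
  analyticAt := hd.analyticAt.congr h.symm
  apply_zero := h.self_of_nhds.trans hd.apply_zero
  deriv_zero := h.deriv_eq.trans hd.deriv_zero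
  deriv_deriv := by
    filter_upwards [h, h.deriv.deriv, hd.deriv_deriv] with u h1 h2 h3
    rw [h2, h3, h1]

/-- Local data exist, and a germ solving the initial value problem agrees with their `cos ψ` on a
smaller disc. From here on only the differential equation matters. -/
lemma isDn2_iff {κ : ℝ} {d : ℂ → ℂ} :
    IsDn2 κ d ↔ MeromorphicNFOn d Set.univ ∧ IsGerm κ d := by
  refine and_congr_right fun _ ↦ ⟨?_, fun hd ↦ ?_⟩
  · rintro ⟨r, φ, ψ, h, hd⟩
    refine h.isGerm.congr ?_
    filter_upwards [Metric.ball_mem_nhds (0 : ℂ) h.radius_pos] with u hu using hd u hu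
  · obtain ⟨r, φ, ψ, h⟩ := exists_isLocalData κ
    obtain ⟨ε, hε, hball⟩ := Metric.eventually_nhds_iff_ball.1 (hd.eventuallyEq h.isGerm)
    have hsub : Metric.ball (0 : ℂ) (min r ε) ⊆ Metric.ball 0 r :=
      Metric.ball_subset_ball (min_le_left _ _)
    exact ⟨min r ε, φ, ψ, ⟨lt_min h.radius_pos hε, h.analytic_phi.mono hsub, h.phi_zero,
      fun u hu ↦ h.right_inv u (hsub hu), h.left_inv, h.analytic_psi.mono hsub, h.psi_zero,
      fun u hu ↦ h.sin_psi u (hsub hu)⟩,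
      fun u hu ↦ hball u (Metric.ball_subset_ball (min_le_right _ _) hu)⟩

end ShenDn

/-- The identity theorem for meromorphic functions in normal form on the plane. -/
lemma MeromorphicNFOn.eq_of_eventuallyEq {d e : ℂ → ℂ} (hd : MeromorphicNFOn d Set.univ)
    (he : MeromorphicNFOn e Set.univ) {z : ℂ} (h : d =ᶠ[𝓝 z] e) : d = e := by
  have hm : Meromorphic (d - e) := fun u ↦
    (hd (Set.mem_univ u)).meromorphicAt.sub (he (Set.mem_univ u)).meromorphicAt
  have hz : meromorphicOrderAt (d - e) z = ⊤ := by
    rw [meromorphicOrderAt_eq_top_iff]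
    exact (h.filter_mono nhdsWithin_le_nhds).mono fun u hu ↦ by simp [hu]
  ext u
  by_contra hne
  have hu : meromorphicOrderAt (d - e) u = ⊤ := by
    by_contra hu
    exact hm.exists_meromorphicOrderAt_ne_top_iff_forall.1 ⟨u, hu⟩ z hz
  rw [meromorphicOrderAt_eq_top_iff] at hu
  -- Normal form turns agreement on a punctured neighbourhood into agreement at `u` itself, poles
  -- included.
  have hu' : d =ᶠ[𝓝[≠] u] e := hu.mono fun v hv ↦ sub_eq_zero.1 hv
  exact hne (((hd (Set.mem_univ u)).eventuallyEq_nhdsNE_iff_eventuallyEq_nhds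
    (he (Set.mem_univ u))).1 hu').self_of_nhds

lemma ShenDn.IsDn2.unique {κ : ℝ} {d e : ℂ → ℂ} (hd : IsDn2 κ d) (he : IsDn2 κ e) : d = e := by
  rw [isDn2_iff] at hd he
  exact hd.1.eq_of_eventuallyEq he.1 (hd.2.eventuallyEq he.2)

end

/-! ### The Weierstrass function: second derivative, half-periods, conjugation -/

section

open Filter Topology ComplexConjugate

namespace PeriodPair

variable (L : PeriodPair)

lemma tendsto_sq_mul_weierstrassP :
    Tendsto (fun z ↦ z ^ 2 * L.weierstrassP z) (𝓝[≠] 0) (𝓝 1) := by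
  -- The term `(z - 0) ^ 2 / 0 ^ 2` is `0` by the convention for division by zero; it is kept to
  -- match the general formula at a lattice point.
  have hc : ContinuousAt (fun z ↦ (z - 0) ^ 2 * L.weierstrassPExcept 0 z + 1 - (z - 0) ^ 2 / 0 ^ 2)
      0 := by
    have := (L.analyticAt_weierstrassPExcept 0).continuousAt
    simp only [ne_eq, OfNat.ofNat_ne_zero, not_false_eq_true, zero_pow, div_zero]
    fun_prop
  have ht : Tendsto (fun z ↦ (z - 0) ^ 2 * L.weierstrassPExcept 0 z + 1 - (z - 0) ^ 2 / 0 ^ 2)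
      (𝓝[≠] 0) (𝓝 1) := by
    simpa using hc.tendsto.mono_left nhdsWithin_le_nhds
  refine ht.congr' ?_
  filter_upwards [self_mem_nhdsWithin] with z (hz : z ≠ 0)
  rw [← L.ite_eq_one_sub_sq_mul_weierstrassP 0 L.lattice.zero_mem, if_neg hz, sub_zero]

/-- A countable set does not disconnect the plane. This allows the identity theorem to be applied to
`℘'`. -/
lemma isConnected_compl_lattice : IsConnected (L.lattice : Set ℂ)ᶜ := by
  refine Set.Countable.isConnected_compl_of_one_lt_rank (by simp) ?_
  refine (Set.countable_range fun p : ℤ × ℤ ↦ (p.1 : ℂ) * L.ω₁ + p.2 * L.ω₂).mono ?_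
  intro x hx
  obtain ⟨m, n, h⟩ := mem_lattice.1 hx
  exact ⟨(m, n), h⟩

lemma eventually_notMem_lattice (x : ℂ) : ∀ᶠ z in 𝓝[≠] x, z ∉ L.lattice := by
  filter_upwards [self_mem_nhdsWithin,
    mem_nhdsWithin_of_mem_nhds (L.compl_lattice_sdiff_singleton_mem_nhds x)] with z hz hz'
  simp_all

/-- If `℘'` vanished, `z⁶ (4 ℘³ - g₂ ℘ - g₃)` would vanish near `0`, whereas it tends to `4`. -/
lemma not_eqOn_derivWeierstrassP_zero : ¬ Set.EqOn L.derivWeierstrassP 0 (L.lattice : Set ℂ)ᶜ := by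
  intro h
  have ht := L.tendsto_sq_mul_weierstrassP
  have hid : Tendsto (fun z : ℂ ↦ z) (𝓝[≠] 0) (𝓝 0) := tendsto_id.mono_left nhdsWithin_le_nhds
  have h1 : Tendsto (fun z ↦ 4 * (z ^ 2 * L.weierstrassP z) ^ 3 -
      L.g₂ * z ^ 4 * (z ^ 2 * L.weierstrassP z) - L.g₃ * z ^ 6) (𝓝[≠] 0)
      (𝓝 (4 * 1 ^ 3 - L.g₂ * 0 ^ 4 * 1 - L.g₃ * 0 ^ 6)) :=
    (((ht.pow 3).const_mul 4).sub (((hid.pow 4).const_mul _).mul ht)).sub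
      ((hid.pow 6).const_mul _)
  have h2 : Tendsto (fun z ↦ 4 * (z ^ 2 * L.weierstrassP z) ^ 3 -
      L.g₂ * z ^ 4 * (z ^ 2 * L.weierstrassP z) - L.g₃ * z ^ 6) (𝓝[≠] 0) (𝓝 0) := by
    refine tendsto_const_nhds.congr' ?_
    filter_upwards [L.eventually_notMem_lattice 0] with z hz
    have := L.derivWeierstrassP_sq z hz
    rw [h hz] at this
    simp only [Pi.zero_apply] at this
    linear_combination z ^ 6 * this
  have := tendsto_nhds_unique h1 h2
  norm_num at this

/-- `℘'' = 6 ℘² - g₂ / 2` -/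
lemma deriv_derivWeierstrassP {z : ℂ} (hz : z ∉ L.lattice) :
    deriv L.derivWeierstrassP z = 6 * L.weierstrassP z ^ 2 - L.g₂ / 2 := by
  have hP := L.analyticOnNhd_weierstrassP
  have hP' := L.analyticOnNhd_derivWeierstrassP
  rcases (hP' z hz).eventually_eq_zero_or_eventually_ne_zero with h | h
  · exact absurd (hP'.eqOn_zero_of_preconnected_of_eventuallyEq_zero
      L.isConnected_compl_lattice.isPreconnected hz h) L.not_eqOn_derivWeierstrassP_zero
  · have hopen := L.isClosed_lattice.isOpen_compl
    -- Differentiating the first order equation gives the claim multiplied by `2 ℘'`; that factor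
    -- cancels off the isolated zeros of `℘'`, and continuity recovers `z`.
    have he : deriv L.derivWeierstrassP =ᶠ[𝓝[≠] z]
        fun z ↦ 6 * L.weierstrassP z ^ 2 - L.g₂ / 2 := by
      filter_upwards [h, nhdsWithin_le_nhds (hopen.mem_nhds hz)] with w hw hwL
      have d1 : HasDerivAt L.weierstrassP (L.derivWeierstrassP w) w := by
        rw [← L.deriv_weierstrassP]
        exact (hP w hwL).differentiableAt.hasDerivAt
      have d2 := (hP' w hwL).differentiableAt.hasDerivAt
      have e : (fun z ↦ L.derivWeierstrassP z ^ 2) =ᶠ[𝓝 w]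
          fun z ↦ 4 * L.weierstrassP z ^ 3 - L.g₂ * L.weierstrassP z - L.g₃ := by
        filter_upwards [hopen.mem_nhds hwL] with v hv using L.derivWeierstrassP_sq v hv
      have d3 := (d2.fun_pow 2).congr_of_eventuallyEq e.symm
      have d4 := ((((d1.fun_pow 3).const_mul 4).fun_sub (d1.const_mul L.g₂)).sub_const L.g₃)
      have := d3.unique d4
      apply mul_left_cancel₀ hw
      push_cast at this
      linear_combination this / 2
    have hc1 : ContinuousAt (deriv L.derivWeierstrassP) z := (hP' z hz).deriv.continuousAt
    have hc2 : ContinuousAt (fun z ↦ 6 * L.weierstrassP z ^ 2 - L.g₂ / 2) z := by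
      have := (hP z hz).continuousAt
      fun_prop
    exact ((hc1.eventuallyEq_nhds_iff_eventuallyEq_nhdsNE hc2).1 he).self_of_nhds

/-- `℘'` is odd, and `z` and `-z` are congruent modulo the lattice. -/
lemma derivWeierstrassP_eq_zero_of_two_mul_mem {z : ℂ} (hz : 2 * z ∈ L.lattice) :
    L.derivWeierstrassP z = 0 := by
  have h := L.derivWeierstrassP_add_coe (-z) ⟨2 * z, hz⟩
  rw [L.derivWeierstrassP_neg, show -z + 2 * z = z by ring] at h
  linear_combination h / 2

variable {L}

/-- Complex conjugation on a lattice that is stable under it. -/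
def conjEquiv (hL : ∀ l ∈ L.lattice, conj l ∈ L.lattice) : L.lattice ≃ L.lattice where
  toFun l := ⟨conj (l : ℂ), hL l l.2⟩
  invFun l := ⟨conj (l : ℂ), hL l l.2⟩
  left_inv l := by simp
  right_inv l := by simp

lemma weierstrassP_conj (hL : ∀ l ∈ L.lattice, conj l ∈ L.lattice) (z : ℂ) :
    L.weierstrassP (conj z) = conj (L.weierstrassP z) := by
  rw [weierstrassP, weierstrassP, Complex.conj_tsum, ← (conjEquiv hL).tsum_eq]
  simp [conjEquiv]

lemma derivWeierstrassP_conj (hL : ∀ l ∈ L.lattice, conj l ∈ L.lattice) (z : ℂ) :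
    L.derivWeierstrassP (conj z) = conj (L.derivWeierstrassP z) := by
  rw [derivWeierstrassP, derivWeierstrassP, map_neg, Complex.conj_tsum,
    ← (conjEquiv hL).tsum_eq]
  simp [conjEquiv, map_ofNat]

end PeriodPair

end

/-! ### Rectangular lattices: the values of `℘` at the half-periods -/

section

open Filter Topology ComplexConjugate

/-- A continuous real function on a preconnected set that avoids a value stays above it. -/
lemma IsPreconnected.lt_of_forall_ne {s : Set ℝ} (hs : IsPreconnected s) {p : ℝ → ℝ}
    (hp : ContinuousOn p s) {c : ℝ} (hc : ∀ x ∈ s, p x ≠ c) {a : ℝ} (ha : a ∈ s) (hac : c < p a)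
    {b : ℝ} (hb : b ∈ s) : c < p b := by
  by_contra h
  obtain ⟨x, hx, hxc⟩ := hs.intermediate_value hb ha hp ⟨not_lt.1 h, hac.le⟩
  exact hc x hx hxc

/-- A continuous real function on a preconnected set that avoids a value stays below it. -/
lemma IsPreconnected.gt_of_forall_ne {s : Set ℝ} (hs : IsPreconnected s) {p : ℝ → ℝ}
    (hp : ContinuousOn p s) {c : ℝ} (hc : ∀ x ∈ s, p x ≠ c) {a : ℝ} (ha : a ∈ s) (hac : p a < c)
    {b : ℝ} (hb : b ∈ s) : p b < c := by
  by_contra h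
  obtain ⟨x, hx, hxc⟩ := hs.intermediate_value ha hb hp ⟨hac.le, not_lt.1 h⟩
  exact hc x hx hxc

namespace ShenDn

/-- `L` is the rectangular lattice with half-periods `K`, `iK'` and invariants
`g₂ = 4/3 - κ²`, `g₃ = 8/27 - κ²/3`. -/
structure IsRectangular (L : PeriodPair) (κ K K' : ℝ) : Prop where
  K_pos : 0 < K
  K'_pos : 0 < K'
  ω₁_eq : L.ω₁ = 2 * (K : ℂ)
  ω₂_eq : L.ω₂ = 2 * Complex.I * (K' : ℂ)
  g₂_eq : L.g₂ = 4 / 3 - (κ : ℂ) ^ 2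
  g₃_eq : L.g₃ = 8 / 27 - (κ : ℂ) ^ 2 / 3

lemma IsHalfPeriods.exists_isRectangular {κ K K' : ℝ} (h : IsHalfPeriods κ K K') :
    ∃ L : PeriodPair, IsRectangular L κ K K' := by
  obtain ⟨h1, h2, L, h3, h4, h5, h6⟩ := h
  exact ⟨L, h1, h2, h3, h4, h5, h6⟩

lemma continuousOn_re_weierstrassP {L : PeriodPair} {c : ℝ → ℂ} (hc : Continuous c) {s : Set ℝ}
    (hs : ∀ t ∈ s, c t ∉ L.lattice) : ContinuousOn (fun t ↦ (L.weierstrassP (c t)).re) s :=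
  Complex.continuous_re.comp_continuousOn
    (L.analyticOnNhd_weierstrassP.continuousOn.comp hc.continuousOn hs)

namespace IsRectangular

variable {L : PeriodPair} {κ K K' : ℝ}

lemma mem_lattice_iff (h : IsRectangular L κ K K') {z : ℂ} : z ∈ L.lattice ↔
    ∃ m n : ℤ, z.re = 2 * m * K ∧ z.im = 2 * n * K' := by
  rw [PeriodPair.mem_lattice]
  refine exists₂_congr fun m n ↦ ?_
  rw [h.ω₁_eq, h.ω₂_eq, Complex.ext_iff]
  simp only [Complex.add_re, Complex.mul_re, Complex.intCast_re, Complex.intCast_im,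
    Complex.re_ofNat, Complex.im_ofNat, Complex.ofReal_re, Complex.ofReal_im, Complex.I_re,
    Complex.I_im, Complex.add_im, Complex.mul_im]
  constructor <;> rintro ⟨h1, h2⟩ <;> constructor <;> linarith

lemma conj_mem (h : IsRectangular L κ K K') (l : ℂ) (hl : l ∈ L.lattice) : conj l ∈ L.lattice := by
  rw [h.mem_lattice_iff] at hl ⊢
  obtain ⟨m, n, h1, h2⟩ := hl
  exact ⟨m, -n, by simpa using h1, by simp [h2]⟩

lemma notMem_of_re (h : IsRectangular L κ K K')
    {z : ℂ} (h0 : 0 < z.re) (h1 : z.re < 2 * K) : z ∉ L.lattice := by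
  rw [h.mem_lattice_iff]
  rintro ⟨m, n, hm, -⟩
  rw [hm] at h0 h1
  have hK := h.K_pos
  have m0 : (0 : ℝ) < m := by
    by_contra hneg
    nlinarith
  have m1 : (m : ℝ) < 1 := by
    by_contra hneg
    nlinarith
  norm_cast at m0 m1
  omega

lemma notMem_of_im (h : IsRectangular L κ K K')
    {z : ℂ} (h0 : 0 < z.im) (h1 : z.im < 2 * K') : z ∉ L.lattice := by
  rw [h.mem_lattice_iff]
  rintro ⟨m, n, -, hn⟩
  rw [hn] at h0 h1
  have hK := h.K'_pos
  have m0 : (0 : ℝ) < n := by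
    by_contra hneg
    nlinarith
  have m1 : (n : ℝ) < 1 := by
    by_contra hneg
    nlinarith
  norm_cast at m0 m1
  omega

lemma weierstrassP_eq_re_of_sub_mem (h : IsRectangular L κ K K')
    {z : ℂ} (hz : conj z - z ∈ L.lattice) :
    L.weierstrassP z = ((L.weierstrassP z).re : ℂ) := by
  have h1 := PeriodPair.weierstrassP_conj h.conj_mem z
  have h2 := L.weierstrassP_add_coe z ⟨_, hz⟩
  rw [add_sub_cancel, h1] at h2
  exact (Complex.conj_eq_iff_re.1 h2).symm

lemma weierstrassP_eq_re_of_add_mem (h : IsRectangular L κ K K')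
    {z : ℂ} (hz : conj z + z ∈ L.lattice) :
    L.weierstrassP z = ((L.weierstrassP z).re : ℂ) := by
  have h1 := PeriodPair.weierstrassP_conj h.conj_mem z
  have h2 := L.weierstrassP_add_coe (-z) ⟨_, hz⟩
  rw [show -z + (conj z + z) = conj z by ring, h1, L.weierstrassP_neg] at h2
  exact (Complex.conj_eq_iff_re.1 h2).symm

/-- Where `conj z ≡ z` modulo the lattice, `℘'` is real. This covers the horizontal sides of the
rectangle. -/
lemma derivWeierstrassP_sq_of_sub_mem (h : IsRectangular L κ K K')
    {z : ℂ} (hz : conj z - z ∈ L.lattice) :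
    ∃ q : ℝ, 0 ≤ q ∧ L.derivWeierstrassP z ^ 2 = q := by
  have h1 := PeriodPair.derivWeierstrassP_conj h.conj_mem z
  have h2 := L.derivWeierstrassP_add_coe z ⟨_, hz⟩
  rw [add_sub_cancel, h1] at h2
  have h3 := (Complex.conj_eq_iff_re.1 h2).symm
  exact ⟨_, sq_nonneg (L.derivWeierstrassP z).re, by rw [h3]; simp⟩

/-- Where `conj z ≡ -z`, oddness makes `℘'` purely imaginary. This covers the vertical sides. -/
lemma derivWeierstrassP_sq_of_add_mem (h : IsRectangular L κ K K')
    {z : ℂ} (hz : conj z + z ∈ L.lattice) :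
    ∃ q : ℝ, q ≤ 0 ∧ L.derivWeierstrassP z ^ 2 = q := by
  have h1 := PeriodPair.derivWeierstrassP_conj h.conj_mem z
  have h2 := L.derivWeierstrassP_add_coe (-z) ⟨_, hz⟩
  rw [show -z + (conj z + z) = conj z by ring, h1, L.derivWeierstrassP_neg] at h2
  have h3 : (L.derivWeierstrassP z).re = 0 := by
    have := congrArg Complex.re h2
    simp only [Complex.conj_re, Complex.neg_re] at this
    linarith
  refine ⟨-(L.derivWeierstrassP z).im ^ 2, by nlinarith [sq_nonneg (L.derivWeierstrassP z).im], ?_⟩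
  rw [← Complex.re_add_im (L.derivWeierstrassP z), h3]
  simp [mul_pow]

/-- The differential equation of `℘`, with its cubic factored. -/
lemma derivWeierstrassP_sq (h : IsRectangular L κ K K')
    (hκ : κ ^ 2 < 1) {z : ℂ} (hz : z ∉ L.lattice) :
    L.derivWeierstrassP z ^ 2 = 4 * (L.weierstrassP z + 1 / 3) *
      (L.weierstrassP z - (1 / 6 - Real.sqrt (1 - κ ^ 2) / 2 : ℝ)) *
      (L.weierstrassP z - (1 / 6 + Real.sqrt (1 - κ ^ 2) / 2 : ℝ)) := by
  have hs : (Real.sqrt (1 - κ ^ 2) : ℂ) ^ 2 = 1 - κ ^ 2 := by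
    exact_mod_cast Real.sq_sqrt (by linarith : (0 : ℝ) ≤ 1 - κ ^ 2)
  rw [L.derivWeierstrassP_sq z hz, h.g₂_eq, h.g₃_eq]
  push_cast
  linear_combination (L.weierstrassP z + 1 / 3) * hs

lemma cubic_nonneg (h : IsRectangular L κ K K')
    (hκ : κ ^ 2 < 1) {z : ℂ} (hz : z ∉ L.lattice) (hc : conj z - z ∈ L.lattice) :
    0 ≤ ((L.weierstrassP z).re + 1 / 3) *
      ((L.weierstrassP z).re - (1 / 6 - Real.sqrt (1 - κ ^ 2) / 2)) *
      ((L.weierstrassP z).re - (1 / 6 + Real.sqrt (1 - κ ^ 2) / 2)) := by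
  obtain ⟨q, hq, hq'⟩ := h.derivWeierstrassP_sq_of_sub_mem hc
  rw [h.derivWeierstrassP_sq hκ hz, h.weierstrassP_eq_re_of_sub_mem hc] at hq'
  rw [show (1 / 3 : ℂ) = ((1 / 3 : ℝ) : ℂ) by norm_num] at hq'
  norm_cast at hq'
  linarith

lemma cubic_nonpos (h : IsRectangular L κ K K')
    (hκ : κ ^ 2 < 1) {z : ℂ} (hz : z ∉ L.lattice) (hc : conj z + z ∈ L.lattice) :
    ((L.weierstrassP z).re + 1 / 3) *
      ((L.weierstrassP z).re - (1 / 6 - Real.sqrt (1 - κ ^ 2) / 2)) *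
      ((L.weierstrassP z).re - (1 / 6 + Real.sqrt (1 - κ ^ 2) / 2)) ≤ 0 := by
  obtain ⟨q, hq, hq'⟩ := h.derivWeierstrassP_sq_of_add_mem hc
  rw [h.derivWeierstrassP_sq hκ hz, h.weierstrassP_eq_re_of_add_mem hc] at hq'
  rw [show (1 / 3 : ℂ) = ((1 / 3 : ℝ) : ℂ) by norm_num] at hq'
  norm_cast at hq'
  linarith

lemma weierstrassP_half_period (h : IsRectangular L κ K K')
    (hκ : κ ^ 2 < 1) {z : ℂ} (hz : z ∉ L.lattice)
    (hz2 : 2 * z ∈ L.lattice) : L.weierstrassP z = -(1 / 3) ∨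
      L.weierstrassP z = (1 / 6 - Real.sqrt (1 - κ ^ 2) / 2 : ℝ) ∨
      L.weierstrassP z = (1 / 6 + Real.sqrt (1 - κ ^ 2) / 2 : ℝ) := by
  have h1 := h.derivWeierstrassP_sq hκ hz
  rw [L.derivWeierstrassP_eq_zero_of_two_mul_mem hz2] at h1
  have h2 : (L.weierstrassP z + 1 / 3) *
      (L.weierstrassP z - (1 / 6 - Real.sqrt (1 - κ ^ 2) / 2 : ℝ)) *
      (L.weierstrassP z - (1 / 6 + Real.sqrt (1 - κ ^ 2) / 2 : ℝ)) = 0 := by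
    linear_combination -h1 / 4
  rcases mul_eq_zero.1 h2 with h3 | h3
  · rcases mul_eq_zero.1 h3 with h4 | h4
    · exact Or.inl (eq_neg_of_add_eq_zero_left h4)
    · exact Or.inr (Or.inl (sub_eq_zero.1 h4))
  · exact Or.inr (Or.inr (sub_eq_zero.1 h3))

lemma exists_lt_re (h : IsRectangular L κ K K')
    (c : ℝ) : ∃ x ∈ Set.Ioc 0 K, c < (L.weierstrassP (x : ℂ)).re := by
  have ht : Tendsto (fun x : ℝ ↦ (x : ℂ)) (𝓝[>] 0) (𝓝[≠] 0) := by
    refine tendsto_nhdsWithin_iff.2 ⟨?_, ?_⟩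
    · exact (Complex.continuous_ofReal.tendsto' 0 0 (by simp)).mono_left nhdsWithin_le_nhds
    · filter_upwards [self_mem_nhdsWithin] with x (hx : 0 < x)
      simpa using hx.ne'
  have h1 := (Complex.continuous_re.tendsto _).comp (L.tendsto_sq_mul_weierstrassP.comp ht)
  have h2 : Tendsto (fun x : ℝ ↦ c * x ^ 2) (𝓝[>] 0) (𝓝 0) :=
    ((by fun_prop : Continuous fun x : ℝ ↦ c * x ^ 2).tendsto' 0 0 (by simp)).mono_left
      nhdsWithin_le_nhds
  obtain ⟨x, hx, hx0, hxK⟩ := ((h2.eventually_lt h1 (by simp)).and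
    (Ioc_mem_nhdsGT h.K_pos)).exists
  refine ⟨x, ⟨hx0, hxK⟩, ?_⟩
  simp only [Function.comp_apply, ← Complex.ofReal_pow, Complex.re_ofReal_mul] at hx
  have : 0 < x ^ 2 := by positivity
  nlinarith

/-- `z² ℘(z) → 1` and `z²` is negative on the imaginary axis, so `℘` tends to `-∞` there. -/
lemma exists_re_lt (h : IsRectangular L κ K K') (c : ℝ) :
    ∃ y ∈ Set.Ioc 0 K', (L.weierstrassP (Complex.I * (y : ℂ))).re < c := by
  have ht : Tendsto (fun x : ℝ ↦ Complex.I * (x : ℂ)) (𝓝[>] 0) (𝓝[≠] 0) := by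
    refine tendsto_nhdsWithin_iff.2 ⟨?_, ?_⟩
    · exact ((by fun_prop : Continuous fun x : ℝ ↦ Complex.I * (x : ℂ)).tendsto' 0 0
        (by simp)).mono_left nhdsWithin_le_nhds
    · filter_upwards [self_mem_nhdsWithin] with x (hx : 0 < x)
      simpa using hx.ne'
  have h1 := (Complex.continuous_re.tendsto _).comp (L.tendsto_sq_mul_weierstrassP.comp ht)
  have h2 : Tendsto (fun x : ℝ ↦ -c * x ^ 2) (𝓝[>] 0) (𝓝 0) :=
    ((by fun_prop : Continuous fun x : ℝ ↦ -c * x ^ 2).tendsto' 0 0 (by simp)).mono_left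
      nhdsWithin_le_nhds
  obtain ⟨x, hx, hx0, hxK⟩ := ((h2.eventually_lt h1 (by simp)).and
    (Ioc_mem_nhdsGT h.K'_pos)).exists
  refine ⟨x, ⟨hx0, hxK⟩, ?_⟩
  simp only [Function.comp_apply, mul_pow, Complex.I_sq, neg_mul, one_mul, Complex.neg_re,
    ← Complex.ofReal_pow, Complex.re_ofReal_mul] at hx
  have : 0 < x ^ 2 := by positivity
  nlinarith

lemma two_mul_K_mem (h : IsRectangular L κ K K') :
    2 * (K : ℂ) ∈ L.lattice := h.ω₁_eq ▸ L.ω₁_mem_lattice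

lemma two_mul_I_mul_K'_mem (h : IsRectangular L κ K K') :
    2 * (Complex.I * (K' : ℂ)) ∈ L.lattice := by
  rw [← mul_assoc, ← h.ω₂_eq]
  exact L.ω₂_mem_lattice

/-- On `(0, K]` the cubic is nonnegative and `℘` comes down from `+∞`. It cannot cross `1/6`, the
midpoint of the two larger roots, where the cubic is negative; so only the largest root is left. -/
lemma weierstrassP_K (h : IsRectangular L κ K K') (hκ : κ ^ 2 < 1) :
    L.weierstrassP K = (1 / 6 + Real.sqrt (1 - κ ^ 2) / 2 : ℝ) := by
  have hs : 0 < Real.sqrt (1 - κ ^ 2) := Real.sqrt_pos.2 (by linarith)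
  have hK := h.K_pos
  have hmem : ∀ x ∈ Set.Ioc 0 K, (x : ℂ) ∉ L.lattice := fun x hx ↦
    h.notMem_of_re (by simpa using hx.1) (by simpa using (by linarith [hx.2] : x < 2 * K))
  obtain ⟨a, ha, hac⟩ := h.exists_lt_re (1 / 6)
  have hlt : 1 / 6 < (L.weierstrassP (K : ℂ)).re := by
    refine isPreconnected_Ioc.lt_of_forall_ne (p := fun x : ℝ ↦ (L.weierstrassP (x : ℂ)).re)
      (continuousOn_re_weierstrassP Complex.continuous_ofReal hmem) ?_ ha hac ⟨hK, le_rfl⟩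
    intro x hx he
    have := h.cubic_nonneg hκ (hmem x hx) (by simp)
    rw [he] at this
    nlinarith
  rcases h.weierstrassP_half_period hκ (hmem K ⟨hK, le_rfl⟩) h.two_mul_K_mem with h1 | h1 | h1
  · rw [h1] at hlt
    norm_num at hlt
  · rw [h1, Complex.ofReal_re] at hlt
    linarith
  · exact h1

/-- On `i(0, K']` the cubic is nonpositive and `℘` comes up from `-∞`. The barrier is `-1/12 - λ/4`,
the midpoint of the two smaller roots, where the cubic is positive. -/
lemma weierstrassP_I_mul_K' (h : IsRectangular L κ K K') (hκ : κ ^ 2 < 1) (hκ₀ : 0 < κ ^ 2) :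
    L.weierstrassP (Complex.I * K') = -(1 / 3) := by
  have hs : 0 < Real.sqrt (1 - κ ^ 2) := Real.sqrt_pos.2 (by linarith)
  have hs1 : Real.sqrt (1 - κ ^ 2) < 1 := by
    rw [Real.sqrt_lt' one_pos]; linarith
  have hK := h.K'_pos
  have hmem : ∀ x ∈ Set.Ioc 0 K', Complex.I * (x : ℂ) ∉ L.lattice := fun x hx ↦
    h.notMem_of_im (by simpa using hx.1) (by simpa using (by linarith [hx.2] : x < 2 * K'))
  obtain ⟨a, ha, hac⟩ := h.exists_re_lt (-(1 / 12) - Real.sqrt (1 - κ ^ 2) / 4)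
  have hlt : (L.weierstrassP (Complex.I * K')).re < -(1 / 12) - Real.sqrt (1 - κ ^ 2) / 4 := by
    refine isPreconnected_Ioc.gt_of_forall_ne
      (p := fun x : ℝ ↦ (L.weierstrassP (Complex.I * (x : ℂ))).re)
      (continuousOn_re_weierstrassP (by fun_prop) hmem) ?_ ha hac ⟨hK, le_rfl⟩
    intro x hx he
    have := h.cubic_nonpos hκ (hmem x hx) (by simp)
    rw [he] at this
    -- At the barrier the product is `(1 - λ)² (1 + 3 λ) / 64`.
    nlinarith [mul_pos (sub_pos.2 hs1) (sub_pos.2 hs1)]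
  rcases h.weierstrassP_half_period hκ (hmem K' ⟨hK, le_rfl⟩) h.two_mul_I_mul_K'_mem
    with h1 | h1 | h1
  · exact h1
  · rw [h1, Complex.ofReal_re] at hlt
    linarith
  · rw [h1, Complex.ofReal_re] at hlt
    linarith

/-- Going up from `K`, `℘` stays above the lower barrier; going right from `iK'`, it stays below
`1/6`. Only the middle root lies between. -/
lemma weierstrassP_K_add_I_mul_K' (h : IsRectangular L κ K K') (hκ : κ ^ 2 < 1) (hκ₀ : 0 < κ ^ 2) :
    L.weierstrassP (K + Complex.I * K') = (1 / 6 - Real.sqrt (1 - κ ^ 2) / 2 : ℝ) := by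
  have hs : 0 < Real.sqrt (1 - κ ^ 2) := Real.sqrt_pos.2 (by linarith)
  have hs1 : Real.sqrt (1 - κ ^ 2) < 1 := by
    rw [Real.sqrt_lt' one_pos]; linarith
  have hK := h.K_pos
  have hK' := h.K'_pos
  have hmemC : ∀ y ∈ Set.Icc 0 K', (K : ℂ) + Complex.I * (y : ℂ) ∉ L.lattice := fun y hy ↦
    h.notMem_of_re (by simpa using hK) (by simpa using (by linarith : K < 2 * K))
  have hmemD : ∀ x ∈ Set.Icc 0 K, (x : ℂ) + Complex.I * (K' : ℂ) ∉ L.lattice := fun x hx ↦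
    h.notMem_of_im (by simpa using hK') (by simpa using (by linarith : K' < 2 * K'))
  have hlow : -(1 / 12) - Real.sqrt (1 - κ ^ 2) / 4 < (L.weierstrassP (K + Complex.I * K')).re := by
    refine isPreconnected_Icc.lt_of_forall_ne
      (p := fun y : ℝ ↦ (L.weierstrassP ((K : ℂ) + Complex.I * (y : ℂ))).re)
      (continuousOn_re_weierstrassP (by fun_prop) hmemC) ?_ (Set.left_mem_Icc.2 hK'.le) ?_
      (Set.right_mem_Icc.2 hK'.le)
    · intro y hy he
      have := h.cubic_nonpos hκ (hmemC y hy) (by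
        convert h.two_mul_K_mem using 1
        simp; ring)
      rw [he] at this
      nlinarith [mul_pos (sub_pos.2 hs1) (sub_pos.2 hs1)]
    · simp only [Complex.ofReal_zero, mul_zero, add_zero, h.weierstrassP_K hκ, Complex.ofReal_re]
      linarith
  have hupp : (L.weierstrassP (K + Complex.I * K')).re < 1 / 6 := by
    refine isPreconnected_Icc.gt_of_forall_ne
      (p := fun x : ℝ ↦ (L.weierstrassP ((x : ℂ) + Complex.I * (K' : ℂ))).re)
      (continuousOn_re_weierstrassP (by fun_prop) hmemD) ?_ (Set.left_mem_Icc.2 hK.le) ?_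
      (Set.right_mem_Icc.2 hK.le)
    · intro x hx he
      have := h.cubic_nonneg hκ (hmemD x hx) (by
        convert neg_mem h.two_mul_I_mul_K'_mem using 1
        simp; ring)
      rw [he] at this
      nlinarith
    · simp only [Complex.ofReal_zero, zero_add, h.weierstrassP_I_mul_K' hκ hκ₀]
      norm_num
  rcases h.weierstrassP_half_period hκ (hmemC K' (Set.right_mem_Icc.2 hK'.le))
    (by rw [mul_add]; exact add_mem h.two_mul_K_mem h.two_mul_I_mul_K'_mem) with h1 | h1 | h1
  · rw [h1] at hlow
    norm_num at hlow
    linarith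
  · exact h1
  · rw [h1, Complex.ofReal_re] at hupp
    linarith

end IsRectangular

end ShenDn

end

/-! ### The elliptic model of `dn₂`, its periods and the uniqueness of the half-periods -/

section

open Filter Topology

namespace ShenDn

open Classical in
/-- The elliptic function `1/3 - 2 ℘(u + iK')`, with value `0` at its poles. -/
noncomputable def ellipticDn (L : PeriodPair) (K' : ℝ) (u : ℂ) : ℂ :=
  if u + Complex.I * K' ∈ L.lattice then 0 else 1 / 3 - 2 * L.weierstrassP (u + Complex.I * K')

section

variable (L : PeriodPair) (K' : ℝ)

lemma ellipticDn_of_notMem {u : ℂ} (hu : u + Complex.I * K' ∉ L.lattice) :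
    ellipticDn L K' u = 1 / 3 - 2 * L.weierstrassP (u + Complex.I * K') := if_neg hu

lemma ellipticDn_of_mem {u : ℂ} (hu : u + Complex.I * K' ∈ L.lattice) :
    ellipticDn L K' u = 0 := if_pos hu

lemma ellipticDn_periodic {ω : ℂ} (hω : ω ∈ L.lattice) :
    Function.Periodic (ellipticDn L K') ω := by
  intro u
  have h1 : u + ω + Complex.I * K' ∈ L.lattice ↔ u + Complex.I * K' ∈ L.lattice := by
    rw [add_right_comm]
    exact L.lattice.add_mem_iff_left hω
  have h2 : L.weierstrassP (u + Complex.I * K' + ω) = _ :=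
    L.weierstrassP_add_coe (u + Complex.I * K') ⟨ω, hω⟩
  rw [add_right_comm] at h2
  by_cases hu : u + Complex.I * K' ∈ L.lattice
  · rw [ellipticDn_of_mem L K' hu, ellipticDn_of_mem L K' (h1.2 hu)]
  · rw [ellipticDn_of_notMem L K' hu, ellipticDn_of_notMem L K' (h1.not.2 hu), h2]

lemma ellipticDn_eventuallyEq {u : ℂ} (hu : u + Complex.I * K' ∉ L.lattice) :
    ellipticDn L K' =ᶠ[𝓝 u] fun u ↦ 1 / 3 - 2 * L.weierstrassP (u + Complex.I * K') := by
  have hc : ContinuousAt (fun u : ℂ ↦ u + Complex.I * K') u := by fun_prop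
  filter_upwards [hc.preimage_mem_nhds (L.isClosed_lattice.isOpen_compl.mem_nhds hu)] with v hv
  exact ellipticDn_of_notMem L K' hv

lemma ellipticDn_eventuallyEq_nhdsNE (u : ℂ) :
    ellipticDn L K' =ᶠ[𝓝[≠] u]
      (fun _ ↦ (1 / 3 : ℂ)) + fun u ↦ -2 * (L.weierstrassP ∘ (· + Complex.I * K')) u := by
  have ht : Tendsto (fun v : ℂ ↦ v + Complex.I * K') (𝓝[≠] u) (𝓝[≠] (u + Complex.I * K')) := by
    refine tendsto_nhdsWithin_iff.2 ⟨?_, ?_⟩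
    · exact (by fun_prop : Continuous fun v : ℂ ↦ v + Complex.I * K').continuousAt.tendsto.mono_left
        nhdsWithin_le_nhds
    · filter_upwards [self_mem_nhdsWithin] with v hv
      simpa using hv
  filter_upwards [ht.eventually (L.eventually_notMem_lattice _)] with v hv
  rw [ellipticDn_of_notMem L K' hv]
  simp
  ring

lemma analyticAt_ellipticDn {u : ℂ} (hu : u + Complex.I * K' ∉ L.lattice) :
    AnalyticAt ℂ (ellipticDn L K') u := by
  refine AnalyticAt.congr ?_ (ellipticDn_eventuallyEq L K' hu).symm
  have h1 : AnalyticAt ℂ (fun u ↦ L.weierstrassP (u + Complex.I * K')) u :=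
    (L.analyticOnNhd_weierstrassP _ hu).fun_comp (f := fun u ↦ u + Complex.I * K') (by fun_prop)
  fun_prop

lemma meromorphicAt_weierstrassP_comp (u : ℂ) :
    MeromorphicAt (fun u ↦ -2 * (L.weierstrassP ∘ (· + Complex.I * (K' : ℂ))) u) u := by
  have : MeromorphicAt (L.weierstrassP ∘ (· + Complex.I * (K' : ℂ))) u :=
    meromorphicAt_comp_add_const_iff_meromorphicAt.2 (L.meromorphic_weierstrassP _)
  fun_prop

lemma meromorphicOrderAt_ellipticDn {u : ℂ} (hu : u + Complex.I * K' ∈ L.lattice) :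
    meromorphicOrderAt (ellipticDn L K') u = ((-2 : ℤ) : WithTop ℤ) := by
  have hm := meromorphicAt_weierstrassP_comp L K' u
  have ho : meromorphicOrderAt
      (fun u ↦ -2 * (L.weierstrassP ∘ (· + Complex.I * (K' : ℂ))) u) u = -2 := by
    have hm' : MeromorphicAt (L.weierstrassP ∘ (· + Complex.I * (K' : ℂ))) u :=
      meromorphicAt_comp_add_const_iff_meromorphicAt.2 (L.meromorphic_weierstrassP _)
    rw [show (fun u ↦ -2 * (L.weierstrassP ∘ (· + Complex.I * (K' : ℂ))) u) =
        (fun _ ↦ (-2 : ℂ)) * (L.weierstrassP ∘ (· + Complex.I * (K' : ℂ))) from rfl,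
      meromorphicOrderAt_mul (by fun_prop) hm', meromorphicOrderAt_const,
      meromorphicOrderAt_comp_add_const_eq_meromorphicOrderAt, L.order_weierstrassP _ hu]
    simp
  rw [meromorphicOrderAt_congr (ellipticDn_eventuallyEq_nhdsNE L K' u),
    meromorphicOrderAt_add_eq_right_of_lt (by fun_prop), ho]
  · rfl
  · rw [ho, meromorphicOrderAt_const, if_neg (by norm_num)]
    decide

lemma meromorphicNFOn_ellipticDn : MeromorphicNFOn (ellipticDn L K') Set.univ := by
  intro u _
  rw [meromorphicNFAt_iff_analyticAt_or]
  by_cases hu : u + Complex.I * K' ∈ L.lattice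
  · refine Or.inr ⟨?_, ?_, ellipticDn_of_mem L K' hu⟩
    · refine MeromorphicAt.congr ?_ (ellipticDn_eventuallyEq_nhdsNE L K' u).symm
      exact (MeromorphicAt.const _ _).add (meromorphicAt_weierstrassP_comp L K' u)
    · rw [meromorphicOrderAt_ellipticDn L K' hu]
      exact_mod_cast (by norm_num : (-2 : ℤ) < 0)
  · exact Or.inl (analyticAt_ellipticDn L K' hu)

/-- The poles form a single coset of the lattice; a period outside the lattice would carry the pole
`-iK'` to a regular point. -/
lemma ellipticDn_periodic_iff {ω : ℂ} :
    Function.Periodic (ellipticDn L K') ω ↔ ω ∈ L.lattice := by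
  refine ⟨fun hω ↦ ?_, ellipticDn_periodic L K'⟩
  by_contra hn
  have h1 : AnalyticAt ℂ (ellipticDn L K') (-(Complex.I * K') + ω) :=
    analyticAt_ellipticDn L K' (by rwa [add_right_comm, neg_add_cancel, zero_add])
  have h2 : AnalyticAt ℂ (fun u ↦ ellipticDn L K' (u + ω)) (-(Complex.I * K')) :=
    h1.fun_comp (f := fun u ↦ u + ω) (by fun_prop)
  rw [show (fun u ↦ ellipticDn L K' (u + ω)) = ellipticDn L K' from funext hω] at h2
  have h3 := meromorphicOrderAt_ellipticDn L K' (u := -(Complex.I * K'))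
    (by rw [neg_add_cancel]; exact L.lattice.zero_mem)
  have h4 := h2.meromorphicOrderAt_nonneg
  rw [h3] at h4
  exact absurd h4 (by decide)

end

namespace IsRectangular

variable {L : PeriodPair} {κ K K' : ℝ}

lemma isGerm_ellipticDn (h : IsRectangular L κ K K') (hκ : κ ^ 2 < 1) (hκ₀ : 0 < κ ^ 2) :
    IsGerm κ (ellipticDn L K') := by
  have hK' := h.K'_pos
  have h0 : (0 : ℂ) + Complex.I * K' ∉ L.lattice :=
    h.notMem_of_im (by simpa using hK') (by simpa using (by linarith : K' < 2 * K'))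
  have hD := ellipticDn_eventuallyEq L K' h0
  have hmem : ∀ᶠ u in 𝓝 (0 : ℂ), u + Complex.I * K' ∉ L.lattice :=
    (by fun_prop : Continuous fun u : ℂ ↦ u + Complex.I * K').continuousAt.preimage_mem_nhds
      (L.isClosed_lattice.isOpen_compl.mem_nhds h0)
  have hd : ∀ᶠ u in 𝓝 (0 : ℂ), deriv (ellipticDn L K') u =
      -2 * L.derivWeierstrassP (u + Complex.I * K') := by
    filter_upwards [hD.eventuallyEq_nhds, hmem] with u h1 h2
    have h3 : HasDerivAt L.weierstrassP (L.derivWeierstrassP (u + Complex.I * K'))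
        (u + Complex.I * K') := by
      rw [← L.deriv_weierstrassP]
      exact (L.analyticOnNhd_weierstrassP _ h2).differentiableAt.hasDerivAt
    rw [h1.deriv_eq, (((h3.comp_add_const u _).const_mul 2).const_sub (1 / 3)).deriv]
    ring
  refine ⟨analyticAt_ellipticDn L K' h0, ?_, ?_, ?_⟩
  · rw [ellipticDn_of_notMem L K' h0, zero_add, h.weierstrassP_I_mul_K' hκ hκ₀]
    norm_num
  · rw [hd.self_of_nhds, zero_add,
      L.derivWeierstrassP_eq_zero_of_two_mul_mem h.two_mul_I_mul_K'_mem, mul_zero]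
  · filter_upwards [hd.eventually_nhds, hD, hmem] with u h1 h2 h3
    have h4 := (L.analyticOnNhd_derivWeierstrassP _ h3).differentiableAt.hasDerivAt
    rw [Filter.EventuallyEq.deriv_eq h1, ((h4.comp_add_const u _).const_mul (-2)).deriv,
      L.deriv_derivWeierstrassP h3, h.g₂_eq, h2]
    ring

lemma isDn2_ellipticDn (h : IsRectangular L κ K K') (hκ : κ ^ 2 < 1) (hκ₀ : 0 < κ ^ 2) :
    IsDn2 κ (ellipticDn L K') :=
  isDn2_iff.2 ⟨meromorphicNFOn_ellipticDn L K', h.isGerm_ellipticDn hκ hκ₀⟩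

lemma isFundamentalPeriods (h : IsRectangular L κ K K') :
    IsFundamentalPeriods (ellipticDn L K') (2 * (K : ℂ)) (2 * Complex.I * (K' : ℂ)) := by
  rw [← h.ω₁_eq, ← h.ω₂_eq]
  refine ⟨L.indep, fun ω ↦ ?_⟩
  rw [ellipticDn_periodic_iff, PeriodPair.mem_lattice]
  simp only [eq_comm]

lemma ellipticDn_K (h : IsRectangular L κ K K') (hκ : κ ^ 2 < 1) (hκ₀ : 0 < κ ^ 2) :
    ellipticDn L K' K = (Real.sqrt (1 - κ ^ 2) : ℝ) := by
  have hK := h.K_pos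
  rw [ellipticDn_of_notMem, h.weierstrassP_K_add_I_mul_K' hκ hκ₀]
  · push_cast
    ring
  · exact h.notMem_of_re (by simpa using hK) (by simpa using (by linarith : K < 2 * K))

lemma ellipticDn_K_add_I_mul_K' (h : IsRectangular L κ K K') (hκ : κ ^ 2 < 1) :
    ellipticDn L K' (K + Complex.I * K') = -(Real.sqrt (1 - κ ^ 2) : ℝ) := by
  have hK := h.K_pos
  -- The shift by `iK'` in the model leads to `K + 2iK'`, which is congruent to `K`.
  have hP : L.weierstrassP (K + 2 * (Complex.I * K')) = _ :=
    L.weierstrassP_add_coe K ⟨_, h.two_mul_I_mul_K'_mem⟩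
  rw [two_mul, ← add_assoc] at hP
  rw [ellipticDn_of_notMem, hP, h.weierstrassP_K hκ]
  · push_cast
    ring
  · exact h.notMem_of_re (by simpa using hK) (by simpa using (by linarith : K < 2 * K))

/-- The half-periods are determined by the lattice. -/
lemma eq_of_lattice_eq {M : PeriodPair} {J J' : ℝ} (h : IsRectangular L κ K K')
    (hM : IsRectangular M κ J J') (hLM : ∀ z, z ∈ L.lattice ↔ z ∈ M.lattice) :
    K = J ∧ K' = J' := by
  have key : ∀ {L M : PeriodPair} {K K' J J' : ℝ}, IsRectangular L κ K K' →
      IsRectangular M κ J J' → (∀ z, z ∈ L.lattice → z ∈ M.lattice) → J ≤ K ∧ J' ≤ K' := by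
    intro L M K K' J J' h hM hLM
    constructor
    · by_contra hlt
      refine hM.notMem_of_re (z := 2 * (K : ℂ)) ?_ ?_ (hLM _ h.two_mul_K_mem)
      · simpa using h.K_pos
      · simpa using not_le.1 hlt
    · by_contra hlt
      refine hM.notMem_of_im (z := 2 * (Complex.I * (K' : ℂ))) ?_ ?_
        (hLM _ h.two_mul_I_mul_K'_mem)
      · simpa using h.K'_pos
      · simpa using not_le.1 hlt
  obtain ⟨h1, h2⟩ := key h hM fun z ↦ (hLM z).1
  obtain ⟨h3, h4⟩ := key hM h fun z ↦ (hLM z).2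
  exact ⟨le_antisymm h3 h1, le_antisymm h4 h2⟩

/-- Both lattices produce the same `dn₂`, and each is its group of periods. -/
lemma half_periods_unique {M : PeriodPair} {J J' : ℝ} (h : IsRectangular L κ K K')
    (hM : IsRectangular M κ J J') (hκ : κ ^ 2 < 1) (hκ₀ : 0 < κ ^ 2) : K = J ∧ K' = J' := by
  refine h.eq_of_lattice_eq hM fun z ↦ ?_
  rw [← ellipticDn_periodic_iff L K', ← ellipticDn_periodic_iff M J',
    (h.isDn2_ellipticDn hκ hκ₀).unique (hM.isDn2_ellipticDn hκ hκ₀)]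

end IsRectangular

end ShenDn

end

/-! ### Existence of the half-periods: Eisenstein series on the imaginary axis -/

section

open Filter Topology UpperHalfPlane ModularForm EisensteinSeries
open scoped ArithmeticFunction.sigma MatrixGroups

namespace ShenDn

/-- The real number `E_k(it)`. -/
noncomputable def eisAxis {k : ℕ} (hk : 3 ≤ k) (t : ℝ) : ℝ :=
  (E hk (ofComplex (Complex.I * t))).re

lemma coe_ofComplex_I_mul {t : ℝ} (ht : 0 < t) :
    ((ofComplex (Complex.I * t) : ℍ) : ℂ) = Complex.I * t := by
  rw [ofComplex_apply_of_im_pos (by simpa)]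

lemma E_ofComplex_I_mul {k : ℕ} (hk : 3 ≤ k) (hk2 : Even k) {t : ℝ} (ht : 0 < t) :
    E hk (ofComplex (Complex.I * t)) = ((1 - (2 * k / bernoulli k : ℚ) *
      ∑' n : ℕ+, (σ (k - 1) n : ℝ) * Real.exp (-2 * Real.pi * t) ^ (n : ℕ) : ℝ) : ℂ) := by
  rw [q_expansion_bernoulli hk hk2, coe_ofComplex_I_mul ht,
    show 2 * (Real.pi : ℂ) * Complex.I * (Complex.I * t) = ((-2 * Real.pi * t : ℝ) : ℂ) by
      push_cast; linear_combination 2 * (Real.pi : ℂ) * t * Complex.I_sq]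
  push_cast
  simp only [zpow_natCast]

lemma ofReal_eisAxis {k : ℕ} (hk : 3 ≤ k) (hk2 : Even k) {t : ℝ} (ht : 0 < t) :
    (eisAxis hk t : ℂ) = E hk (ofComplex (Complex.I * t)) := by
  rw [eisAxis, E_ofComplex_I_mul hk hk2 ht, Complex.ofReal_re]

/-- `B₄ = -1/30`, so the nonconstant coefficients of `E₄` are positive, and `q = exp (-2πt)` is
positive. -/
lemma eisAxis_four_pos {t : ℝ} (ht : 0 < t) : 0 < eisAxis (by norm_num : 3 ≤ 4) t := by
  rw [eisAxis, E_ofComplex_I_mul _ ⟨2, rfl⟩ ht, Complex.ofReal_re,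
    bernoulli_eq_bernoulli'_of_ne_one (by norm_num), bernoulli'_four]
  have : 0 ≤ ∑' n : ℕ+, (σ (4 - 1) n : ℝ) * Real.exp (-2 * Real.pi * t) ^ (n : ℕ) :=
    tsum_nonneg fun n ↦ by positivity
  norm_num at this ⊢
  linarith

lemma continuousOn_eisAxis {k : ℕ} (hk : 3 ≤ k) : ContinuousOn (eisAxis hk) (Set.Ioi 0) := by
  have h1 : Continuous (E hk) := (ModularFormClass.holo (E hk)).continuous
  have h2 : ContinuousOn (fun t : ℝ ↦ ofComplex (Complex.I * t)) (Set.Ioi 0) := by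
    intro t ht
    have h3 : ContinuousAt ofComplex (Complex.I * t) :=
      (contMDiffAt_ofComplex (n := 0) (by simpa using ht)).continuousAt
    exact (ContinuousAt.comp (f := fun t : ℝ ↦ Complex.I * t) h3 (by fun_prop)).continuousWithinAt
  exact Complex.continuous_re.comp_continuousOn (h1.comp_continuousOn h2)

lemma tendsto_ofComplex_I_mul :
    Tendsto (fun t : ℝ ↦ ofComplex (Complex.I * t)) atTop atImInfty := by
  rw [atImInfty, tendsto_comap_iff]
  refine tendsto_id.congr' ?_
  filter_upwards [eventually_gt_atTop 0] with t ht
  simp [ofComplex_apply_of_im_pos, ht, ← coe_im]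

lemma tendsto_eisAxis {k : ℕ} (hk : 3 ≤ k) (hk2 : Even k) :
    Tendsto (eisAxis hk) atTop (𝓝 1) := by
  have hv : valueAtInfty (E hk) = 1 := by
    rw [← E_qExpansion_coeff_zero hk hk2,
      UpperHalfPlane.qExpansion_coeff_zero one_pos
        (ModularFormClass.analyticAt_cuspFunction_zero (E hk) one_pos one_mem_strictPeriods_SL)
        (SlashInvariantFormClass.periodic_comp_ofComplex (E hk) one_mem_strictPeriods_SL)]
  obtain ⟨c, hc, hO⟩ := ModularFormClass.exp_decay_sub_atImInfty' (E hk)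
  have h1 : Tendsto (fun τ : ℍ ↦ Real.exp (-c * τ.im)) atImInfty (𝓝 0) := by
    have : Tendsto (fun τ : ℍ ↦ τ.im) atImInfty atTop := tendsto_comap
    refine Real.tendsto_exp_atBot.comp ?_
    exact this.const_mul_atTop_of_neg (by linarith)
  have h2 := (hO.trans_tendsto h1).comp tendsto_ofComplex_I_mul
  rw [hv] at h2
  have h3 := (Complex.continuous_re.tendsto _).comp (h2.add_const 1)
  change Tendsto (fun t : ℝ ↦ (E hk (ofComplex (Complex.I * t))).re) atTop (𝓝 1)
  simpa [Function.comp_def] using h3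

lemma E_S_smul {k : ℕ} (hk : 3 ≤ k) (z : ℍ) :
    E hk (ModularGroup.S • z) = (z : ℂ) ^ k * E hk z := by
  have hmem : ((ModularGroup.S : SL(2, ℤ)) : GL (Fin 2) ℝ) ∈ 𝒮ℒ := ⟨_, rfl⟩
  have h : E hk (ModularGroup.S • z) = denom ((ModularGroup.S : SL(2, ℤ)) : GL (Fin 2) ℝ) z ^
      (k : ℤ) * E hk z := SlashInvariantForm.slash_action_eqn'' (E hk) hmem z
  have hd : denom ((ModularGroup.S : SL(2, ℤ)) : GL (Fin 2) ℝ) z = z := by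
    simp [denom, ModularGroup.coe_S]
  rw [h, hd, zpow_natCast]

lemma eisAxis_inv {k : ℕ} (hk : 3 ≤ k) (hk2 : Even k) {t : ℝ} (ht : 0 < t) :
    eisAxis hk t⁻¹ = (-1) ^ (k / 2) * t ^ k * eisAxis hk t := by
  have h1 : ofComplex (Complex.I * (t⁻¹ : ℝ)) = ModularGroup.S • ofComplex (Complex.I * t) := by
    ext
    rw [modular_S_smul, coe_ofComplex_I_mul (inv_pos.2 ht)]
    simp only [coe_ofComplex_I_mul ht]
    simp [mul_comm]
  have h2 : (Complex.I * t) ^ k = (((-1) ^ (k / 2) * t ^ k : ℝ) : ℂ) := by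
    obtain ⟨m, rfl⟩ := hk2
    rw [← two_mul, Nat.mul_div_cancel_left m two_pos, mul_pow, pow_mul, Complex.I_sq]
    push_cast
    rfl
  have h3 : (eisAxis hk t⁻¹ : ℂ) = (((-1) ^ (k / 2) * t ^ k * eisAxis hk t : ℝ) : ℂ) := by
    rw [ofReal_eisAxis hk hk2 (inv_pos.2 ht), h1, E_S_smul, coe_ofComplex_I_mul ht, h2,
      ← ofReal_eisAxis hk hk2 ht]
    push_cast
    rfl
  exact_mod_cast h3

lemma tsum_eisSummand_eq {k : ℕ} (hk : 3 ≤ k) (z : ℍ) :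
    ∑' v, eisSummand k v z = 2 * riemannZeta k * E hk z := by
  rw [tsum_eisSummand_eq_riemannZeta_mul_eisensteinSeries hk,
    show E hk z = (1 / 2 : ℂ) • eisensteinSeriesSIF (N := 1) 0 k z from rfl,
    eisensteinSeriesSIF_apply 0 k z, smul_eq_mul]
  ring

/-- The rectangular lattice with half-periods `K` and `itK`. -/
noncomputable def rectangle {K t : ℝ} (hK : 0 < K) (ht : 0 < t) : PeriodPair where
  ω₁ := 2 * (K : ℂ)
  ω₂ := 2 * Complex.I * ((t * K : ℝ) : ℂ)
  indep := by
    rw [LinearIndependent.pair_iff]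
    intro a b hab
    have h1 := congrArg Complex.re hab
    have h2 := congrArg Complex.im hab
    simp at h1 h2
    exact ⟨h1.resolve_right hK.ne', h2.resolve_right (not_or.2 ⟨ht.ne', hK.ne'⟩)⟩

lemma rectangle_G {K t : ℝ} (hK : 0 < K) (ht : 0 < t) {k : ℕ} (hk : 3 ≤ k) (hk2 : Even k) :
    (rectangle hK ht).G k = ((2 * (K : ℂ)) ^ k)⁻¹ * (2 * riemannZeta k * eisAxis hk t) := by
  set L := rectangle hK ht
  rw [ofReal_eisAxis hk hk2 ht, ← tsum_eisSummand_eq, ← tsum_mul_left, PeriodPair.G,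
    -- The coordinates are swapped because `eisSummand` attaches `v 0` to `τ = it`, which is the
    -- direction of `ω₂`.
    ← L.latticeEquivProd.symm.toEquiv.tsum_eq,
    ← ((finTwoArrowEquiv ℤ).trans (Equiv.prodComm ℤ ℤ)).tsum_eq]
  refine tsum_congr fun v ↦ ?_
  have h1 : ((L.latticeEquivProd.symm (v 1, v 0) : L.lattice) : ℂ) =
      2 * K * (v 0 * (Complex.I * t) + v 1) := by
    rw [PeriodPair.latticeEquiv_symm_apply]
    simp only [L, rectangle]
    push_cast
    ring
  rw [eisSummand, coe_ofComplex_I_mul ht, zpow_neg, zpow_natCast, ← mul_inv, ← mul_pow, ← h1]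
  rfl

lemma riemannZeta_six : riemannZeta 6 = Real.pi ^ 6 / 945 := by
  have hb : bernoulli 6 = 1 / 42 := by
    rw [bernoulli_eq_bernoulli'_of_ne_one (by norm_num), bernoulli'_def]
    have h5 : bernoulli' 5 = 0 := bernoulli'_eq_zero_of_odd (by decide) (by norm_num)
    norm_num [Finset.sum_range_succ, h5, Nat.choose]
  have := riemannZeta_two_mul_nat (k := 3) (by norm_num)
  norm_num [hb, Nat.factorial] at this
  rw [this]
  ring

lemma rectangle_g₂ {K t : ℝ} (hK : 0 < K) (ht : 0 < t) :
    (rectangle hK ht).g₂ =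
      4 / 3 * (Real.pi / (2 * K)) ^ 4 * eisAxis (by norm_num : 3 ≤ 4) t := by
  have hK' : (K : ℂ) ≠ 0 := by exact_mod_cast hK.ne'
  rw [PeriodPair.g₂, rectangle_G hK ht (by norm_num : 3 ≤ 4) ⟨2, rfl⟩]
  push_cast
  rw [riemannZeta_four]
  field_simp
  ring

lemma rectangle_g₃ {K t : ℝ} (hK : 0 < K) (ht : 0 < t) :
    (rectangle hK ht).g₃ =
      8 / 27 * (Real.pi / (2 * K)) ^ 6 * eisAxis (by norm_num : 3 ≤ 6) t := by
  have hK' : (K : ℂ) ≠ 0 := by exact_mod_cast hK.ne'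
  rw [PeriodPair.g₃, rectangle_G hK ht (by norm_num : 3 ≤ 6) ⟨3, rfl⟩]
  push_cast
  rw [riemannZeta_six]
  field_simp
  ring

/-- Every real number of absolute value less than `1` is a value of `E₆ / E₄ ^ (3/2)` on the
imaginary axis. -/
lemma exists_eisAxis_eq {c : ℝ} (hc : |c| < 1) : ∃ t : ℝ, 0 < t ∧
    eisAxis (by norm_num : 3 ≤ 6) t = c * Real.sqrt (eisAxis (by norm_num : 3 ≤ 4) t) ^ 3 := by
  set a := eisAxis (by norm_num : 3 ≤ 4)
  set b := eisAxis (by norm_num : 3 ≤ 6)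
  have ha : ∀ t, 0 < t → 0 < Real.sqrt (a t) := fun t ht ↦ Real.sqrt_pos.2 (eisAxis_four_pos ht)
  let q : ℝ → ℝ := fun t ↦ b t / Real.sqrt (a t) ^ 3
  have hq : ContinuousOn q (Set.Ioi 0) :=
    (continuousOn_eisAxis _).div ((continuousOn_eisAxis _).sqrt.pow 3)
      fun t ht ↦ (pow_pos (ha t ht) 3).ne'
  have hlim : Tendsto q atTop (𝓝 1) := by
    have := (tendsto_eisAxis (by norm_num : 3 ≤ 6) ⟨3, rfl⟩).div
      ((tendsto_eisAxis (by norm_num : 3 ≤ 4) ⟨2, rfl⟩).sqrt.pow 3) (by norm_num)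
    rw [Real.sqrt_one, one_pow, div_one] at this
    exact this
  -- The inversion `τ ↦ -1/τ` multiplies `E₄` by `t⁴` and `E₆` by `-t⁶`. With the limit `1` at
  -- infinity, `q` thus also comes arbitrarily close to `-1`.
  have hinv : ∀ t, 0 < t → q t⁻¹ = -q t := by
    intro t ht
    have h4 : a t⁻¹ = t ^ 4 * a t := by
      simpa using eisAxis_inv (by norm_num : 3 ≤ 4) ⟨2, rfl⟩ ht
    have h6 : b t⁻¹ = -(t ^ 6) * b t := by
      have := eisAxis_inv (by norm_num : 3 ≤ 6) ⟨3, rfl⟩ ht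
      norm_num at this
      rw [neg_mul]
      exact this
    have hs : Real.sqrt (a t⁻¹) = t ^ 2 * Real.sqrt (a t) := by
      rw [h4, Real.sqrt_mul (by positivity), show t ^ 4 = (t ^ 2) ^ 2 by ring,
        Real.sqrt_sq (by positivity)]
    have := ha t ht
    simp only [q, hs, h6]
    field_simp
  rw [abs_lt] at hc
  obtain ⟨t₁, h₁, ht₁⟩ := ((hlim.eventually_const_lt hc.2).and (eventually_gt_atTop 0)).exists
  obtain ⟨t₂, h₂, ht₂⟩ := ((hlim.eventually_const_lt (neg_lt.1 hc.1)).and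
    (eventually_gt_atTop 0)).exists
  have h₂' : q t₂⁻¹ ≤ c := by
    rw [hinv t₂ ht₂]
    linarith
  obtain ⟨t, ht, hqt⟩ := isPreconnected_Ioi.intermediate_value (Set.mem_Ioi.2 (inv_pos.2 ht₂))
    (Set.mem_Ioi.2 ht₁) hq ⟨h₂', h₁.le⟩
  refine ⟨t, ht, ?_⟩
  rw [← hqt, div_mul_cancel₀ _ (pow_pos (ha t ht) 3).ne']

lemma exists_isHalfPeriods {κ : ℝ} (hκ : κ ^ 2 < 1) (hκ₀ : 0 < κ ^ 2) :
    ∃ K K' : ℝ, IsHalfPeriods κ K K' := by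
  -- `A` and `B` are `g₂ / (4/3)` and `g₃ / (8/27)`, to be matched with `s⁴ E₄(it)` and `s⁶ E₆(it)`,
  -- where `s = π / (2K)`.
  set A := 1 - 3 / 4 * κ ^ 2
  set B := 1 - 9 / 8 * κ ^ 2
  have hA : 0 < A := by simp only [A]; linarith
  have hsA : 0 < Real.sqrt A := Real.sqrt_pos.2 hA
  have hAs : Real.sqrt A ^ 2 = A := Real.sq_sqrt hA.le
  have hc : |B / Real.sqrt A ^ 3| < 1 := by
    rw [← sq_lt_one_iff_abs_lt_one, div_pow, div_lt_one (by positivity),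
      show (Real.sqrt A ^ 3) ^ 2 = (Real.sqrt A ^ 2) ^ 3 by ring, hAs]
    -- Up to a constant this is the discriminant of the cubic; its positivity is what `0 < κ² < 1`
    -- provides.
    have : A ^ 3 - B ^ 2 = 27 / 64 * (κ ^ 2) ^ 2 * (1 - κ ^ 2) := by
      simp only [A, B]; ring
    have h2 : 0 < 27 / 64 * (κ ^ 2) ^ 2 * (1 - κ ^ 2) :=
      mul_pos (by positivity) (by linarith)
    linarith
  obtain ⟨t, ht, hb⟩ := exists_eisAxis_eq hc
  set a := eisAxis (by norm_num : 3 ≤ 4) t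
  set b := eisAxis (by norm_num : 3 ≤ 6) t
  have ha : 0 < a := eisAxis_four_pos ht
  have hsa : 0 < Real.sqrt a := Real.sqrt_pos.2 ha
  have has : Real.sqrt a ^ 2 = a := Real.sq_sqrt ha.le
  set s := Real.sqrt (Real.sqrt A / Real.sqrt a)
  have hs : 0 < s := Real.sqrt_pos.2 (by positivity)
  have hs2 : s ^ 2 = Real.sqrt A / Real.sqrt a := Real.sq_sqrt (by positivity)
  have h4 : s ^ 4 * a = A := by
    rw [show s ^ 4 = (s ^ 2) ^ 2 by ring, hs2, div_pow, has, hAs]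
    field_simp
  have h6 : s ^ 6 * b = B := by
    rw [show s ^ 6 = (s ^ 2) ^ 3 by ring, hs2, hb]
    field_simp
  have hK : 0 < Real.pi / (2 * s) := by positivity
  have hπ : ((Real.pi : ℂ) / (2 * ((Real.pi / (2 * s) : ℝ) : ℂ))) = s := by
    have h1 : (Real.pi : ℂ) ≠ 0 := by exact_mod_cast Real.pi_ne_zero
    have h2 : (s : ℂ) ≠ 0 := by exact_mod_cast hs.ne'
    push_cast
    field_simp
  refine ⟨Real.pi / (2 * s), t * (Real.pi / (2 * s)), hK, mul_pos ht hK, rectangle hK ht, rfl, rfl,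
    ?_, ?_⟩
  · rw [rectangle_g₂, hπ, mul_assoc]
    have : (s : ℂ) ^ 4 * a = A := by exact_mod_cast h4
    rw [this]
    simp only [A]
    push_cast
    ring
  · rw [rectangle_g₃, hπ, mul_assoc]
    have : (s : ℂ) ^ 6 * b = B := by exact_mod_cast h6
    rw [this]
    simp only [B]
    push_cast
    ring

end ShenDn

end

theorem mainTheorem8 (κ : ℝ) (hκ₀ : 0 < κ) (hκ₁ : κ < 1) :
    (∃! d : ℂ → ℂ, ShenDn.IsDn2 κ d) ∧
    (∃! P : ℝ × ℝ, ShenDn.IsHalfPeriods κ P.1 P.2) ∧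
    ∀ (d : ℂ → ℂ) (K K' : ℝ), ShenDn.IsDn2 κ d → ShenDn.IsHalfPeriods κ K K' →
      ShenDn.IsFundamentalPeriods d (2 * (K : ℂ)) (2 * Complex.I * (K' : ℂ)) ∧
      meromorphicOrderAt d (Complex.I * (K' : ℂ)) = ((-2 : ℤ) : WithTop ℤ) ∧
      d (K : ℂ) = ((Real.sqrt (1 - κ ^ 2) : ℝ) : ℂ) ∧
      d ((K : ℂ) + Complex.I * (K' : ℂ)) = -((Real.sqrt (1 - κ ^ 2) : ℝ) : ℂ) := by
  have hpos : 0 < κ ^ 2 := by positivity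
  have hlt : κ ^ 2 < 1 := by nlinarith
  obtain ⟨K, K', hK⟩ := ShenDn.exists_isHalfPeriods hlt hpos
  obtain ⟨L, hL⟩ := hK.exists_isRectangular
  refine ⟨⟨_, hL.isDn2_ellipticDn hlt hpos, fun e he ↦ he.unique (hL.isDn2_ellipticDn hlt hpos)⟩,
    ⟨(K, K'), hK, ?_⟩, ?_⟩
  · rintro ⟨J, J'⟩ hJ
    obtain ⟨M, hM⟩ := hJ.exists_isRectangular
    obtain ⟨h1, h2⟩ := hM.half_periods_unique hL hlt hpos
    exact Prod.ext h1 h2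
  · intro d J J' hd hJ
    obtain ⟨M, hM⟩ := hJ.exists_isRectangular
    rw [hd.unique (hM.isDn2_ellipticDn hlt hpos)]
    refine ⟨hM.isFundamentalPeriods, ShenDn.meromorphicOrderAt_ellipticDn M J' ?_,
      hM.ellipticDn_K hlt hpos, hM.ellipticDn_K_add_I_mul_K' hlt⟩
    rw [← two_mul]
    exact hM.two_mul_I_mul_K'_mem
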